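/- **Conventions.** $\mathcal S$ is the category with objects the sets $\underline n=\{1,\dots,n\}$ $(n\in\mathbb N)$ and arbitrary functions as maps. For $\varphi:\underline m\to\underline n$ and $i\in\underline n$, $\varepsilon_{\varphi,i}:\varphi^{-1}(i)\to\underline m$ is the unique monotone injection from an object $\varphi^{-1}(i)$ of $\mathcal S$ with image $\{j:\varphi(j)=i\}$, and for $\psi:\underline\ell\to\underline m$, $\psi^\varphi_i:(\varphi\psi)^{-1}(i)\to\varphi^{-1}(i)$ is the map with $\varepsilon_{\varphi,i}\,\psi^\varphi_i=\psi\,\varepsilon_{\varphi\psi,i}$. A small category $\mathcal C$ is *endowed with local terminal objects* if each connected component has a chosen terminal object; $\tau_X:X\to uX$ is the unique map to the chosen terminal object in the component of $X$. $\mathbf{Cat}/\!/\mathcal S$ has as objects small categories $\mathcal C$ with a functor $|{-}|:\mathcal C\to\mathcal S$, and as maps $\mathcal C\to\mathcal C'$ pairs $(F,\nu)$ of a functor $F:\mathcal C\to\mathcal C'$ and a natural transformation $\nu:|{-}|_{\mathcal C}\Rightarrow|F{-}|_{\mathcal C'}$. $\mathbf{Cat}_{\ell t}/\!/\mathcal S$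 is the analogous category in which $\mathcal C$ is endowed with local terminal objects, $|X|=\underline 1$ for each chosen terminal $X$, and $F$ preserves chosen terminals. A map $(F,\nu)$ is *strict* if $\nu$ is an identity (in particular $|{-}|_{\mathcal C}=|F{-}|_{\mathcal C'}$). The forgetful functor $\mathbf{Cat}_{\ell t}/\!/\mathcal S\to\mathbf{Cat}/\!/\mathcal S$ has a right adjoint sending $\mathcal C$ to $D_m(\mathcal C)=\sum_{X\in\mathcal C,\,i\in|X|}\mathcal C/X$, with chosen terminals the objects $(X,i,1_X)$ and with $|(X,i,f)|=|f|^{-1}(i)$, and on maps $g:(X,i,fg)\to(X,i,f)$, $|g|^{|f|}_i$; the counit consists of the slice projections $(X,i,f:Y\to X)\mapsto Y$ together with the maps $\varepsilon_{|f|,i}:|f|^{-1}(i)\to|Y|$. The *modified décalage monad* $\mathsf{\tilde D}_m$ on $\mathbf{Cat}_{\ell t}/\!/\mathcal S$ is the monad induced by this adjunction. A *lax-operadic category* is an object $(\mathcal C,|{-}|)$ of $\mathbf{Cat}_{\ell t}/\!/\mathcal S$ with functors $\varphi_{X,i}:\mathcal C/X\to\mathcal C$ for $X\in\mathcal C$,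 $i\in|X|$, written $f\mapsto f^{-1}(i)$ and $(g:fg\to f)\mapsto g^f_i$, and functions $\gamma_{f,i}:|f|^{-1}(i)\to|f^{-1}(i)|$, such that: - $(1_X)^{-1}(i)$ is a chosen terminal; - $|g^f_i|\circ\gamma_{fg,i}=\gamma_{f,i}\circ|g|^{|f|}_i$; - $\tau_X^{-1}(*)=X$, $f^{\tau_X}_*=f$ for $f:Y\to X$, and $\gamma_{\tau_X,*}=1_{|X|}$; - for $j\in|f|^{-1}(i)$, writing $\gamma j=\gamma_{f,i}(j)$ and $\varepsilon j=\varepsilon_{|f|,i}(j)$: $(g^f_i)^{-1}(\gamma j)=g^{-1}(\varepsilon j)$, $(h^{fg}_i)^{g^f_i}_{\gamma j}=h^g_{\varepsilon j}$, and $\gamma_{g^f_i,\gamma j}\circ\bar\gamma_{fg,i}=\gamma_{g,\varepsilon j}$, where $\bar\gamma_{fg,i}:(|g|^{|f|}_i)^{-1}(j)\to|g^f_i|^{-1}(\gamma j)$ is the restriction of $\gamma_{fg,i}$ to fibres and $(|g|^{|f|}_i)^{-1}(j)=|g|^{-1}(\varepsilon j)$. A *lax-operadic functor* is a map $(F,\nu)$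 of $\mathbf{Cat}_{\ell t}/\!/\mathcal S$ with $F(f^{-1}(i))=(Ff)^{-1}(\nu_X i)$, $F(g^f_i)=(Fg)^{Ff}_{\nu_X i}$ and $\nu_{f^{-1}(i)}\circ\gamma_{f,i}=\gamma_{Ff,\nu_X i}\circ\bar\nu$ for $f:Y\to X$, where $\bar\nu:|f|^{-1}(i)\to|Ff|^{-1}(\nu_X i)$ is the restriction of $\nu_Y$. An *operadic category* is given by $(\mathcal C,|{-}|)$ and functors $\varphi_{X,i}$ as above such that $(1_X)^{-1}(i)$ is a chosen terminal; $|f^{-1}(i)|=|f|^{-1}(i)$ and $|g^f_i|=|g|^{|f|}_i$; $\tau_X^{-1}(*)=X$ and $f^{\tau_X}_*=f$; and $(g^f_i)^{-1}(j)=g^{-1}(\varepsilon j)$ and $(h^{fg}_i)^{g^f_i}_j=h^g_{\varepsilon j}$ for $j\in|f|^{-1}(i)$. An *operadic functor* is a functor $F$ which preserves chosen terminals, satisfies $|F{-}|=|{-}|$, and satisfies $F(f^{-1}(i))=(Ff)^{-1}(i)$ and $F(g^f_i)=(Fg)^{Ff}_i$. Operadic categories and functors are regarded as lax-operadic ones with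 all $\gamma_{f,i}$, respectively all $\nu_X$, identities. The category of $\mathsf{\tilde D}_m$-algebras is isomorphic to the category of lax-operadic categories, by the isomorphism which is the identity on the underlying objects and maps of $\mathbf{Cat}_{\ell t}/\!/\mathcal S$, and which takes a structure map $(\varphi,\gamma):D_m(\mathcal C)\to\mathcal C$ to the fibre functors $\varphi_{X,i}=\varphi|_{\mathcal C/X}$ and relabelling functions $\gamma_{f,i}=\gamma_{(X,i,f)}$. **Proposition.** Under this isomorphism, a $\mathsf{\tilde D}_m$-algebra corresponds to an operadic category if and only if its algebra structure map in $\mathbf{Cat}_{\ell t}/\!/\mathcal S$ is strict; and a morphism between $\mathsf{\tilde D}_m$-algebras which correspond to operadic categories corresponds to an operadic functor if and only if its underlying map in $\mathbf{Cat}_{\ell t}/\!/\mathcal S$ is strict. -/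

import Mathlib

open CategoryTheory

universe u

noncomputable section

namespace Decalage

/-! ### The category of finite ordinals and arbitrary maps -/

/-- The objects of the category `𝒮`: one finite set `{1, …, n}` (modelled by `Fin n`)
for each natural number `n`. -/
@[ext]
structure FinS : Type where
  /-- The number of elements. -/
  size : ℕ

namespace FinS

/-- Maps of `𝒮` are arbitrary functions. -/
@[ext]
structure Hom (m n : FinS) : Type where
  /-- The underlying function. -/
  toFun : Fin m.size → Fin n.size

instance : Category FinS where
  Hom := Hom
  id _ := ⟨fun x => x⟩
  comp f g := ⟨fun x => g.toFun (f.toFun x)⟩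

@[simp] theorem id_toFun (m : FinS) (x : Fin m.size) : Hom.toFun (𝟙 m) x = x := rfl

@[simp] theorem comp_toFun {l m n : FinS} (f : l ⟶ m) (g : m ⟶ n) (x : Fin l.size) :
    Hom.toFun (f ≫ g) x = g.toFun (f.toFun x) := rfl

theorem hom_ext {m n : FinS} {f g : m ⟶ n} (h : ∀ x, f.toFun x = g.toFun x) : f = g :=
  Hom.ext (funext h)

theorem eqToHom_toFun_val {m n : FinS} (h : m = n) (x : Fin m.size) :
    ((eqToHom h).toFun x : ℕ) = x := by
  subst h; rfl

variable {l m n : FinS}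

/-- The set `{ j | φ j = i }`. -/
def fibreSet (φ : m ⟶ n) (i : Fin n.size) : Finset (Fin m.size) :=
  Finset.univ.filter fun j => φ.toFun j = i

/-- The fibre `φ⁻¹(i)`, as an object of `𝒮`. -/
def fibre (φ : m ⟶ n) (i : Fin n.size) : FinS := ⟨(fibreSet φ i).card⟩

/-- The unique monotone injection `ε_{φ,i} : φ⁻¹(i) ⟶ m` with image `{ j | φ j = i }`. -/
def incl (φ : m ⟶ n) (i : Fin n.size) : fibre φ i ⟶ m :=
  ⟨fun k => (fibreSet φ i).orderEmbOfFin rfl k⟩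

theorem incl_prop (φ : m ⟶ n) (i : Fin n.size) (k : Fin (fibre φ i).size) :
    φ.toFun ((incl φ i).toFun k) = i :=
  (Finset.mem_filter.mp ((fibreSet φ i).orderEmbOfFin_mem rfl k)).2

theorem incl_injective (φ : m ⟶ n) (i : Fin n.size) : Function.Injective (incl φ i).toFun :=
  ((fibreSet φ i).orderEmbOfFin rfl).injective

/-- The position in the fibre `φ⁻¹(i)` of an element `x` with `φ x = i`. -/
def index (φ : m ⟶ n) (i : Fin n.size) (x : Fin m.size) (hx : φ.toFun x = i) :
    Fin (fibre φ i).size :=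
  ((fibreSet φ i).orderIsoOfFin rfl).symm ⟨x, Finset.mem_filter.mpr ⟨Finset.mem_univ _, hx⟩⟩

@[simp] theorem incl_index (φ : m ⟶ n) (i : Fin n.size) (x : Fin m.size) (hx : φ.toFun x = i) :
    (incl φ i).toFun (index φ i x hx) = x := by
  have h := (fibreSet φ i).coe_orderIsoOfFin_apply rfl (index φ i x hx)
  rw [index, OrderIso.apply_symm_apply] at h
  exact h.symm

/-- The map induced on fibres by `a : m ⟶ m'`, if `a` carries elements over `i` to elements
over `i'`: the unique map `k` with `k ≫ ε_{φ',i'} = ε_{φ,i} ≫ a`. -/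
def fibreMap {m' n' : FinS} (φ : m ⟶ n) (φ' : m' ⟶ n') (a : m ⟶ m') (i : Fin n.size)
    (i' : Fin n'.size) (h : ∀ x, φ.toFun x = i → φ'.toFun (a.toFun x) = i') :
    fibre φ i ⟶ fibre φ' i' :=
  ⟨fun k => index φ' i' (a.toFun ((incl φ i).toFun k)) (h _ (incl_prop φ i k))⟩

@[simp] theorem incl_fibreMap {m' n' : FinS} (φ : m ⟶ n) (φ' : m' ⟶ n') (a : m ⟶ m')
    (i : Fin n.size) (i' : Fin n'.size) (h : ∀ x, φ.toFun x = i → φ'.toFun (a.toFun x) = i')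
    (k : Fin (fibre φ i).size) :
    (incl φ' i').toFun ((fibreMap φ φ' a i i' h).toFun k) = a.toFun ((incl φ i).toFun k) :=
  incl_index _ _ _ (h _ (incl_prop φ i k))

theorem comm_apply {φ : l ⟶ m} {ψ : m ⟶ n} {χ : l ⟶ n} (w : φ ≫ ψ = χ) (x : Fin l.size) :
    ψ.toFun (φ.toFun x) = χ.toFun x := by
  subst w; rfl

/-- The fibre functor `𝒮/n ⥤ 𝒮` at `i`: it sends `φ` to `φ⁻¹(i)` and `ψ : φψ ⟶ φ` to the
fibre map `ψ^φ_i`. -/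
def fibreFunctor (n : FinS) (i : Fin n.size) : Over n ⥤ FinS where
  obj φ := fibre φ.hom i
  map {φ χ} ψ := fibreMap φ.hom χ.hom ψ.left i i
    fun x hx => (comm_apply (Over.w ψ) x).trans hx
  map_id φ := hom_ext fun x => incl_injective _ _ (by simp)
  map_comp f g := hom_ext fun x => incl_injective _ _ (by simp)

/-- If `ψ : l ⟶ m`, then `φψ⁻¹(i) ⟶ φ⁻¹(i)` is iterated: the fibre of the fibre map
`ψ^φ_i` at `j` has as many elements as the fibre of `ψ` at `ε j`. -/
theorem fibre_fibreMap (ψ : l ⟶ m) (φ : m ⟶ n) (χ : l ⟶ n) (w : ψ ≫ φ = χ) (i : Fin n.size)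
    (j : Fin (fibre φ i).size) :
    fibre (fibreMap χ φ ψ i i fun x hx => (comm_apply w x).trans hx) j =
      fibre ψ ((incl φ i).toFun j) := by
  apply FinS.ext
  change (fibreSet _ _).card = (fibreSet _ _).card
  refine Finset.card_bij (fun k _ => (incl χ i).toFun k) ?_ ?_ ?_
  · intro k hk
    have hk := (Finset.mem_filter.mp hk).2
    refine Finset.mem_filter.mpr ⟨Finset.mem_univ _, ?_⟩
    rw [← hk, incl_fibreMap]
  · intro a _ b _ h
    exact incl_injective _ _ h
  · intro x hx
    have hx := (Finset.mem_filter.mp hx).2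
    have hχ : χ.toFun x = i := by
      rw [← comm_apply w, hx, incl_prop]
    refine ⟨index χ i x hχ, Finset.mem_filter.mpr ⟨Finset.mem_univ _, ?_⟩, incl_index _ _ _ _⟩
    apply incl_injective
    rw [incl_fibreMap, incl_index, hx]

end FinS

/-! ### Local terminal objects -/

/-- A category endowed with local terminal objects: each connected component comes with a chosen
terminal object of that component. -/
@[ext]
structure LocalTerminals (C : Type u) [SmallCategory C] : Type u where
  /-- The object chosen in a connected component. -/
  chosen : CategoryTheory.ConnectedComponents C → C
  /-- The chosen object lies in its component. -/
  mk_chosen : ∀ c, CategoryTheory.ConnectedComponents.mk (chosen c) = c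
  /-- The chosen object is terminal in its component. -/
  terminal : ∀ (c : CategoryTheory.ConnectedComponents C) (X : C), CategoryTheory.ConnectedComponents.mk X = c →
    Nonempty (Unique (X ⟶ chosen c))

namespace LocalTerminals

variable {C : Type u} [SmallCategory C] (t : LocalTerminals C)

/-- The property of being one of the chosen local terminal objects. -/
def IsChosen (X : C) : Prop := ∃ c, t.chosen c = X

/-- `uX` is the chosen terminal object in the connected component of `X`. -/
def u (X : C) : C := t.chosen (CategoryTheory.ConnectedComponents.mk X)

/-- The unique map `τ_X : X ⟶ uX`. -/
def τ (X : C) : X ⟶ t.u X := (t.terminal _ X rfl).some.default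

variable {t}

theorem isChosen_u (X : C) : t.IsChosen (t.u X) := ⟨_, rfl⟩

theorem mk_eq {X Y : C} (f : X ⟶ Y) : CategoryTheory.ConnectedComponents.mk X = CategoryTheory.ConnectedComponents.mk Y :=
  Quotient.sound (s := Zigzag.setoid C) (Zigzag.of_hom f)

theorem u_eq {X Y : C} (f : X ⟶ Y) : t.u X = t.u Y := congrArg t.chosen (mk_eq f)

theorem IsChosen.u_eq {X : C} (h : t.IsChosen X) : t.u X = X := by
  obtain ⟨c, rfl⟩ := h
  exact congrArg t.chosen (t.mk_chosen c)

theorem hom_ext {X T : C} (hT : t.IsChosen T) (f g : X ⟶ T) : f = g := by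
  obtain ⟨c, rfl⟩ := hT
  have := (t.terminal c X ((mk_eq f).trans (t.mk_chosen c))).some
  exact Subsingleton.elim f g

theorem eq_of_hom {X Y : C} (f : X ⟶ Y) (hX : t.IsChosen X) (hY : t.IsChosen Y) : X = Y :=
  hX.u_eq.symm.trans ((LocalTerminals.u_eq f).trans hY.u_eq)

end LocalTerminals

/-! ### The lax slice categories -/

/-- An object of the lax slice `Cat // 𝒮`: a small category with a functor to `𝒮`. -/
structure CatOverS : Type (u + 1) where
  /-- The underlying category. -/
  C : Type u
  /-- Its category structure. -/
  [cat : SmallCategory C]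
  /-- The cardinality functor `|-|`. -/
  card : C ⥤ FinS

attribute [instance] CatOverS.cat

namespace CatOverS

/-- A map of `Cat // 𝒮`: a functor `F` and a natural transformation `ν : |-| ⟶ |F -|`. -/
structure Hom (A B : CatOverS.{u}) : Type u where
  /-- The functor. -/
  F : A.C ⥤ B.C
  /-- The natural transformation filling the triangle. -/
  ν : A.card ⟶ F ⋙ B.card

variable {A B : CatOverS.{u}}

theorem Hom.ext {f g : Hom A B} (hobj : ∀ X, f.F.obj X = g.F.obj X)
    (hmap : ∀ (X Y : A.C) (k : X ⟶ Y), HEq (f.F.map k) (g.F.map k))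
    (hν : ∀ (X : A.C) (i : Fin (A.card.obj X).size),
      ((f.ν.app X).toFun i : ℕ) = (g.ν.app X).toFun i) : f = g := by
  obtain ⟨F, ν⟩ := f
  obtain ⟨G, ν'⟩ := g
  obtain rfl : F = G := Functor.hext hobj hmap
  congr 1
  ext X : 2
  exact FinS.hom_ext fun i => Fin.ext (hν X i)

instance : Category CatOverS.{u} where
  Hom := Hom
  id A := ⟨𝟭 A.C, 𝟙 _⟩
  comp f g := ⟨f.F ⋙ g.F, f.ν ≫ Functor.whiskerLeft f.F g.ν⟩

end CatOverS

/-- An object of the lax slice `Cat_ℓt // 𝒮`: a small category endowed with local terminal objects,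
and a functor `|-|` to `𝒮` which preserves chosen local terminals; the only chosen
terminal object of `𝒮` is the set with one element. -/
structure CatLtOverS : Type (u + 1) extends CatOverS.{u} where
  /-- The local terminal objects. -/
  lt : LocalTerminals C
  /-- If `X` is a chosen local terminal then `|X| = 1`. -/
  card_chosen : ∀ X, lt.IsChosen X → card.obj X = ⟨1⟩

namespace CatLtOverS

/-- A map of `Cat_ℓt // 𝒮`: a map of `Cat // 𝒮` whose functor preserves chosen local terminals. -/
structure Hom (A B : CatLtOverS.{u}) : Type u
    extends CatOverS.Hom A.toCatOverS B.toCatOverS where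
  /-- Chosen local terminals are preserved. -/
  pres : ∀ X, A.lt.IsChosen X → B.lt.IsChosen (F.obj X)

theorem Hom.ext' {A B : CatLtOverS.{u}} {f g : Hom A B} (h : f.toHom = g.toHom) : f = g := by
  cases f; cases g; congr

instance : Category CatLtOverS.{u} where
  Hom := Hom
  id A := ⟨𝟙 A.toCatOverS, fun _ h => h⟩
  comp {A B C} f g :=
    ⟨CategoryStruct.comp (X := A.toCatOverS) (Y := B.toCatOverS) (Z := C.toCatOverS)
      f.toHom g.toHom, fun X h => g.pres _ (f.pres X h)⟩

theorem hom_ext {A B : CatLtOverS.{u}} {f g : A ⟶ B} (hobj : ∀ X, f.F.obj X = g.F.obj X)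
    (hmap : ∀ (X Y : A.C) (k : X ⟶ Y), HEq (f.F.map k) (g.F.map k))
    (hν : ∀ (X : A.C) (i : Fin (A.card.obj X).size),
      ((f.ν.app X).toFun i : ℕ) = (g.ν.app X).toFun i) : f = g :=
  Hom.ext' (CatOverS.Hom.ext hobj hmap hν)

/-- A map `(F, ν)` of `Cat_ℓt // 𝒮` is *strict* if `ν` is an identity: the triangle of functors
commutes, and `ν` is the identity transformation. -/
def IsStrict {A B : CatLtOverS.{u}} (f : A ⟶ B) : Prop :=
  ∃ h : A.card = f.F ⋙ B.card, f.ν = eqToHom h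

/-- The forgetful functor `Cat_ℓt // 𝒮 ⥤ Cat // 𝒮`. -/
def forget : CatLtOverS.{u} ⥤ CatOverS.{u} where
  obj A := A.toCatOverS
  map f := f.toHom

end CatLtOverS

/-! ### Modified décalage -/

namespace Dm

open FinS

section

variable (A : CatOverS.{u})

/-- The category `D_m(C) = ∑_{X ∈ C, i ∈ |X|} C/X`. -/
abbrev Obj : Type u := Σ p : (Σ X : A.C, Fin (A.card.obj X).size), Over p.1

/-- The functor `D_m(C) ⥤ 𝒮` sending `(X, i, f)` to `|f|⁻¹(i)` and `g : (X, i, fg) ⟶ (X, i, f)`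
to the fibre map `|g|^{|f|}_i`. -/
def card : Obj A ⥤ FinS :=
  Sigma.desc fun p => Over.post A.card ⋙ fibreFunctor (A.card.obj p.1) p.2

/-- The copairing `D_m(C) ⥤ C` of the slice projections. -/
def proj : Obj A ⥤ A.C := Sigma.desc fun p => Over.forget p.1

/-- `D_m(C)` as an object of `Cat // 𝒮`. -/
abbrev toOverS : CatOverS.{u} := ⟨Obj A, card A⟩

end

variable {A B : CatOverS.{u}}

/-- The object `(X, i, f)` of `D_m(C)`. -/
abbrev mk (X : A.C) (i : Fin (A.card.obj X).size) {Y : A.C} (f : Y ⟶ X) : Obj A :=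
  ⟨⟨X, i⟩, Over.mk f⟩

/-- The map `g : (X, i, fg) ⟶ (X, i, f)` of `D_m(C)`. -/
abbrev mkMap (X : A.C) (i : Fin (A.card.obj X).size) {Z Y : A.C} (g : Z ⟶ Y) (f : Y ⟶ X) :
    mk X i (g ≫ f) ⟶ mk X i f :=
  Sigma.SigmaHom.mk (Over.homMk g)

theorem mk_congr {X X' : A.C} {i : Fin (A.card.obj X).size} {i' : Fin (A.card.obj X').size}
    {Y Y' : A.C} {f : Y ⟶ X} {f' : Y' ⟶ X'} (hX : X = X') (hi : (i : ℕ) = i') (hY : Y = Y')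
    (hf : HEq f f') : mk X i f = mk X' i' f' := by
  subst hX hY
  obtain rfl := Fin.ext hi
  obtain rfl := eq_of_heq hf
  rfl

/-- The map of `D_m(C)` given by a map in a slice, up to an equality of the indices. -/
def homOf {a b : Obj A} (h : a.1 = b.1) (g : a.2.left ⟶ b.2.left)
    (w : g ≫ b.2.hom = a.2.hom ≫ eqToHom (congrArg Sigma.fst h)) : a ⟶ b :=
  match a, b, h, g, w with
  | ⟨p, f⟩, ⟨_, f'⟩, rfl, g, w =>
    Sigma.SigmaHom.mk (Over.homMk g (by simpa using w))

theorem proj_homOf {a b : Obj A} (h : a.1 = b.1) (g : a.2.left ⟶ b.2.left)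
    (w : g ≫ b.2.hom = a.2.hom ≫ eqToHom (congrArg Sigma.fst h)) :
    (proj A).map (homOf h g w) = g := by
  obtain ⟨p, f⟩ := a
  obtain ⟨q, f'⟩ := b
  dsimp only at h
  subst h
  rfl

theorem proj_injective {a b : Obj A} {f g : a ⟶ b} (h : (proj A).map f = (proj A).map g) :
    f = g := by
  obtain ⟨p, a⟩ := a
  obtain ⟨f⟩ := f
  obtain ⟨g⟩ := g
  exact congrArg Sigma.SigmaHom.mk (Over.OverMorphism.ext h)

theorem heq_of_proj {a b a' b' : Obj A} (ha : a = a') (hb : b = b') {f : a ⟶ b} {g : a' ⟶ b'}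
    (h : HEq ((proj A).map f) ((proj A).map g)) : HEq f g := by
  subst ha hb
  exact heq_of_eq (proj_injective (eq_of_heq h))

variable (A) in
/-- The chosen local terminals of `D_m(C)` are the objects `(X, i, 1_X)`. -/
def lt : LocalTerminals (Obj A) where
  chosen := Quotient.lift (fun a => mk a.1.1 a.1.2 (𝟙 _)) (fun a b h => by
    have key : ∀ {a b : Obj A}, (a ⟶ b) → a.1 = b.1 := by
      rintro ⟨p, a⟩ ⟨q, b⟩ ⟨f⟩; rfl
    have : a.1 = b.1 := by
      induction h with
      | refl => rfl
      | tail _ h ih =>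
        rw [ih]
        rcases h with ⟨⟨f⟩⟩ | ⟨⟨f⟩⟩
        · exact key f
        · exact (key f).symm
    obtain ⟨p, a⟩ := a
    obtain ⟨q, b⟩ := b
    dsimp only at this
    subst this
    rfl)
  mk_chosen c := by
    induction c using Quotient.inductionOn with
    | h a =>
      obtain ⟨p, f⟩ := a
      exact Quotient.sound (s := Zigzag.setoid _)
        (Zigzag.of_inv (Sigma.SigmaHom.mk (Over.mkIdTerminal.from f)))
  terminal c a h := by
    subst h
    obtain ⟨p, f⟩ := a
    refine ⟨⟨⟨Sigma.SigmaHom.mk (Over.mkIdTerminal.from f)⟩, ?_⟩⟩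
    rintro ⟨g⟩
    exact congrArg Sigma.SigmaHom.mk (Over.mkIdTerminal.hom_ext _ _)

theorem isChosen_mk_id (X : A.C) (i : Fin (A.card.obj X).size) :
    (lt A).IsChosen (mk X i (𝟙 X)) :=
  ⟨CategoryTheory.ConnectedComponents.mk (mk X i (𝟙 X)), rfl⟩

theorem isChosen_iff {a : Obj A} :
    (lt A).IsChosen a ↔ ∃ (X : A.C) (i : Fin (A.card.obj X).size), a = mk X i (𝟙 X) := by
  constructor
  · rintro ⟨c, rfl⟩
    induction c using Quotient.inductionOn with
    | h a => exact ⟨_, _, rfl⟩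
  · rintro ⟨X, i, rfl⟩
    exact isChosen_mk_id X i

theorem val_eq_of_incl {a b : Obj A} (h : a = b) (x : Fin ((card A).obj a).size)
    (y : Fin ((card A).obj b).size)
    (hxy : ((incl (A.card.map a.2.hom) a.1.2).toFun x : ℕ) =
      (incl (A.card.map b.2.hom) b.1.2).toFun y) : (x : ℕ) = y := by
  subst h
  exact congrArg Fin.val (incl_injective _ _ (Fin.ext hxy))

theorem card_one {a : Obj A} (h : (lt A).IsChosen a) : (card A).obj a = ⟨1⟩ := by
  obtain ⟨X, i, rfl⟩ := isChosen_iff.mp h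
  apply FinS.ext
  change (fibreSet _ _).card = 1
  refine Finset.card_eq_one.mpr ⟨i, ?_⟩
  ext j
  have : (A.card.map (𝟙 X)).toFun j = j := by rw [A.card.map_id]; rfl
  refine Finset.mem_filter.trans (Iff.trans ⟨fun h => ?_, fun h => ?_⟩ (Finset.mem_singleton (b := j) (a := i)).symm)
  · exact this.symm.trans h.2
  · exact ⟨Finset.mem_univ _, this.trans h⟩

/-- The injections `ε : |f|⁻¹(i) ⟶ |Y|` are natural in `(X, i, f)`. -/
theorem incl_card_map {a b : Obj A} (g : a ⟶ b) (x : Fin ((card A).obj a).size) :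
    (incl (A.card.map b.2.hom) b.1.2).toFun (((card A).map g).toFun x) =
      (A.card.map ((proj A).map g)).toFun ((incl (A.card.map a.2.hom) a.1.2).toFun x) := by
  obtain ⟨p, a⟩ := a
  obtain ⟨g⟩ := g
  exact incl_fibreMap _ _ _ _ _
    (fun x hx => (comm_apply (Over.w ((Over.post A.card).map g)) x).trans hx) _

variable (A) in
/-- The value at `C` of the cofree functor `Cat // 𝒮 ⥤ Cat_ℓt // 𝒮`: the category `D_m(C)`, with
its chosen terminals `1_X` and its cardinality functor. -/
def cofreeObj : CatLtOverS.{u} where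
  toCatOverS := toOverS A
  lt := lt A
  card_chosen _ h := card_one h

theorem over_carry (f : A ⟶ B) {X Y : A.C} (i : Fin (A.card.obj X).size) (g : Y ⟶ X)
    (y : Fin (A.card.obj Y).size) (hy : (A.card.map g).toFun y = i) :
    (B.card.map (f.F.map g)).toFun ((f.ν.app Y).toFun y) = (f.ν.app X).toFun i := by
  rw [← hy]
  exact comm_apply (f.ν.naturality g).symm y

/-- The functor `(X, i, f) ↦ (FX, ν_X i, Ff)` induced by a map `(F, ν)`. -/
def mapFunctor (f : A ⟶ B) : Obj A ⥤ Obj B :=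
  Sigma.desc fun p => Over.post f.F ⋙
    Sigma.incl (C := fun p : (Σ X : B.C, Fin (B.card.obj X).size) => Over p.1)
      ⟨f.F.obj p.1, (f.ν.app p.1).toFun p.2⟩

theorem proj_mapFunctor_map (f : A ⟶ B) {a b : Obj A} (g : a ⟶ b) :
    (proj B).map ((mapFunctor f).map g) = f.F.map ((proj A).map g) := by
  obtain ⟨p, a⟩ := a
  obtain ⟨g⟩ := g
  rfl

/-- The map `|f|⁻¹(i) ⟶ |Ff|⁻¹(ν_X i)` induced by `ν_Y`. -/
def mapν (f : A ⟶ B) (a : Obj A) : (card A).obj a ⟶ (card B).obj ((mapFunctor f).obj a) :=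
  fibreMap (A.card.map a.2.hom) (B.card.map (f.F.map a.2.hom))
    (f.ν.app a.2.left) a.1.2 ((f.ν.app a.1.1).toFun a.1.2) (over_carry f a.1.2 a.2.hom)

theorem incl_mapν (f : A ⟶ B) (a : Obj A) (x : Fin ((card A).obj a).size) :
    (incl (B.card.map (f.F.map a.2.hom)) ((f.ν.app a.1.1).toFun a.1.2)).toFun
        ((mapν f a).toFun x) =
      (f.ν.app a.2.left).toFun ((incl (A.card.map a.2.hom) a.1.2).toFun x) :=
  incl_fibreMap _ _ _ _ _ (over_carry f a.1.2 a.2.hom) _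

theorem mapν_naturality (f : A ⟶ B) {a b : Obj A} (g : a ⟶ b) :
    (card A).map g ≫ mapν f b = mapν f a ≫ (card B).map ((mapFunctor f).map g) := by
  refine FinS.hom_ext fun x =>
    incl_injective (B.card.map (f.F.map b.2.hom)) ((f.ν.app b.1.1).toFun b.1.2) ?_
  refine (incl_mapν f b _).trans ?_
  refine (congrArg _ (incl_card_map g x)).trans ?_
  refine Eq.trans ?_ (incl_card_map ((mapFunctor f).map g) ((mapν f a).toFun x)).symm
  rw [proj_mapFunctor_map]
  refine (comm_apply (f.ν.naturality ((proj A).map g)).symm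
    ((incl (A.card.map a.2.hom) a.1.2).toFun x)).symm.trans ?_
  exact congrArg (B.card.map (f.F.map ((proj A).map g))).toFun (incl_mapν f a x).symm

/-- The action of the cofree functor on maps: `(F, ν)` is sent to the functor
`(X, i, f) ↦ (FX, ν_X i, Ff)`, with the maps `|f|⁻¹(i) ⟶ |Ff|⁻¹(ν_X i)` induced by `ν`. -/
def cofreeMap (f : A ⟶ B) : cofreeObj A ⟶ cofreeObj B where
  F := mapFunctor f
  ν := { app := mapν f, naturality := fun _ _ g => mapν_naturality f g }
  pres a h := by
    obtain ⟨X, i, rfl⟩ := isChosen_iff.mp h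
    refine isChosen_iff.mpr ⟨f.F.obj X, (f.ν.app X).toFun i, ?_⟩
    exact mk_congr rfl rfl rfl (heq_of_eq (f.F.map_id X))

/-- The cofree functor `Cat // 𝒮 ⥤ Cat_ℓt // 𝒮`. -/
def cofree : CatOverS.{u} ⥤ CatLtOverS.{u} where
  obj := cofreeObj
  map := cofreeMap
  map_id A := by
    refine CatLtOverS.hom_ext (fun _ => rfl) ?_ ?_
    · rintro ⟨p, a⟩ ⟨_, b⟩ ⟨g⟩
      rfl
    · intro a x
      refine congrArg Fin.val ?_
      exact incl_injective _ _ (incl_mapν (𝟙 A) a x)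
  map_comp f g := by
    refine CatLtOverS.hom_ext (fun _ => rfl) ?_ ?_
    · rintro ⟨p, a⟩ ⟨_, b⟩ ⟨h⟩
      rfl
    · intro a x
      refine congrArg Fin.val ?_
      refine incl_injective _ _ ((incl_mapν (f ≫ g) a x).trans ?_)
      refine Eq.trans ?_ (incl_mapν g ((mapFunctor f).obj a) _).symm
      exact congrArg _ (incl_mapν f a x).symm

/-- The counit of the forgetful--cofree adjunction: the copairing of the slice projections, with
the natural transformation whose components are the injections `ε : |f|⁻¹(i) ⟶ |Y|`. -/
def counit : cofree.{u} ⋙ CatLtOverS.forget.{u} ⟶ 𝟭 CatOverS.{u} where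
  app A :=
    { F := proj A
      ν :=
        { app := fun a => incl (A.card.map a.2.hom) a.1.2
          naturality := fun a b g => FinS.hom_ext fun x => incl_card_map g x } }
  naturality A B f := by
    refine CatOverS.Hom.ext (fun _ => rfl) ?_ ?_
    · rintro ⟨p, a⟩ ⟨_, b⟩ ⟨g⟩
      rfl
    · intro a x
      exact congrArg Fin.val (incl_mapν f a x)

section unit

variable {A : CatLtOverS.{u}}

/-- The unique element of `|T|`, for `T` a chosen local terminal. -/
def elt {T : A.C} (h : A.lt.IsChosen T) : Fin (A.card.obj T).size :=
  ⟨0, by rw [A.card_chosen T h]; exact Nat.one_pos⟩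

/-- The unique element of `|uX|`. -/
def star (X : A.C) : Fin (A.card.obj (A.lt.u X)).size := elt (LocalTerminals.isChosen_u X)

theorem eq_of_isChosen {T : A.C} (h : A.lt.IsChosen T) (i j : Fin (A.card.obj T).size) : i = j := by
  have h1 : (A.card.obj T).size = 1 := congrArg FinS.size (A.card_chosen _ h)
  apply Fin.ext
  have := i.2
  have := j.2
  omega

theorem star_val {X : A.C} (i : Fin (A.card.obj (A.lt.u X)).size) : i = star X :=
  eq_of_isChosen (LocalTerminals.isChosen_u X) _ _

theorem fibre_of_isChosen {X T : A.C} (h : A.lt.IsChosen T) (f : X ⟶ T)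
    (i : Fin (A.card.obj T).size) : fibreSet (A.card.map f) i = Finset.univ :=
  Finset.filter_true_of_mem fun _ _ => eq_of_isChosen h _ _

theorem incl_of_isChosen {X T : A.C} (h : A.lt.IsChosen T) (f : X ⟶ T)
    (i : Fin (A.card.obj T).size) (x : Fin (fibre (A.card.map f) i).size) :
    ((incl (A.card.map f) i).toFun x : ℕ) = x := by
  have hc : (fibreSet (A.card.map f) i).card = (A.card.obj X).size := by
    rw [fibre_of_isChosen h, Finset.card_univ, Fintype.card_fin]
  have := Finset.orderEmbOfFin_unique (s := fibreSet (A.card.map f) i) rfl (f := Fin.cast hc)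
    (fun y => Finset.mem_filter.mpr ⟨Finset.mem_univ _, eq_of_isChosen h _ _⟩) (Fin.cast_strictMono hc)
  exact (congrArg Fin.val (congrFun this x)).symm

theorem card_τ (X : A.C) : A.card.obj X = fibre (A.card.map (A.lt.τ X)) (star X) := by
  apply FinS.ext
  change _ = (fibreSet _ _).card
  rw [fibre_of_isChosen (LocalTerminals.isChosen_u X)]
  simp

theorem index_eq {X Y : A.C} (f : X ⟶ Y) :
    (⟨A.lt.u X, star X⟩ : Σ X : A.C, Fin (A.card.obj X).size) = ⟨A.lt.u Y, star Y⟩ := by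
  have key : ∀ {S T : A.C} (hST : S = T) (_ : A.lt.IsChosen T) (i : Fin (A.card.obj S).size)
      (j : Fin (A.card.obj T).size),
      (⟨S, i⟩ : Σ X : A.C, Fin (A.card.obj X).size) = ⟨T, j⟩ := by
    rintro S _ rfl h i j
    rw [eq_of_isChosen h i j]
  exact key (LocalTerminals.u_eq f) (LocalTerminals.isChosen_u Y) _ _

variable (A) in
/-- The functor `C ⥤ D_m(C)` sending `X` to `(uX, 1, τ_X)` and `f` to `f`. -/
def unitFunctor : A.C ⥤ Obj A.toCatOverS where
  obj X := mk (A.lt.u X) (star X) (A.lt.τ X)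
  map f := homOf (index_eq f) f (LocalTerminals.hom_ext (LocalTerminals.isChosen_u _) _ _)
  map_id X := proj_injective ((proj_homOf _ _ _).trans
    ((proj A.toCatOverS).map_id (mk (A.lt.u X) (star X) (A.lt.τ X))).symm)
  map_comp f g := proj_injective ((proj_homOf _ _ _).trans (by
    rw [(proj A.toCatOverS).map_comp, proj_homOf, proj_homOf]; rfl))

theorem heq_of_isChosen {X S T : A.C} (h : S = T) (hT : A.lt.IsChosen T) (f : X ⟶ S)
    (g : X ⟶ T) : HEq f g := by
  subst h
  exact heq_of_eq (LocalTerminals.hom_ext hT f g)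

theorem fin_val_of_isChosen {S T : A.C} (h : S = T) (hT : A.lt.IsChosen T)
    (i : Fin (A.card.obj S).size) (j : Fin (A.card.obj T).size) : (i : ℕ) = j := by
  subst h
  exact congrArg Fin.val (eq_of_isChosen hT i j)

/-- An object `(T, i, f)` of `D_m(C)` with `T` a chosen local terminal is `(uX, 1, τ_X)`. -/
theorem mk_eq_unit {X T : A.C} (hT : A.lt.IsChosen T) (i : Fin (A.card.obj T).size) (f : X ⟶ T) :
    (unitFunctor A).obj X = mk T i f := by
  have h : A.lt.u X = T := (LocalTerminals.u_eq f).trans hT.u_eq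
  exact mk_congr h (fin_val_of_isChosen h hT _ _) rfl (heq_of_isChosen h hT _ _)

theorem proj_unitFunctor_map {X Y : A.C} (f : X ⟶ Y) :
    (proj A.toCatOverS).map ((unitFunctor A).map f) = f :=
  proj_homOf _ _ _

theorem eqToHom_card_τ {X Y : A.C} (f : X ⟶ Y) :
    A.card.map f ≫ eqToHom (card_τ Y) =
      eqToHom (card_τ X) ≫ (card A.toCatOverS).map ((unitFunctor A).map f) := by
  have key : ∀ (X : A.C) (x : Fin (A.card.obj X).size),
      (incl (A.card.map (A.lt.τ X)) (star X)).toFun ((eqToHom (card_τ X)).toFun x) = x :=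
    fun X x => Fin.ext ((incl_of_isChosen (LocalTerminals.isChosen_u X) _ _ _).trans
      (eqToHom_toFun_val (card_τ X) x))
  refine FinS.hom_ext fun x => incl_injective (A.card.map (A.lt.τ Y)) (star Y) ?_
  refine (key Y _).trans (Eq.trans ?_ (incl_card_map ((unitFunctor A).map f) _).symm)
  rw [proj_unitFunctor_map]
  exact congrArg (A.card.map f).toFun (key X x).symm

end unit

/-- The unit of the forgetful--cofree adjunction: the functor `X ↦ (uX, 1, τ_X)`, with the
identity transformation given by `|X| = |τ_X|⁻¹(1)`. -/
def unit : 𝟭 CatLtOverS.{u} ⟶ CatLtOverS.forget.{u} ⋙ cofree.{u} where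
  app A :=
    { F := unitFunctor A
      ν := { app := fun X => eqToHom (card_τ X), naturality := fun _ _ f => eqToHom_card_τ f }
      pres := fun X h => isChosen_iff.mpr
        ⟨X, elt h, mk_eq_unit h _ _⟩ }
  naturality A B f := by
    refine CatLtOverS.hom_ext ?_ ?_ ?_
    · intro X
      exact mk_eq_unit (f.pres _ (LocalTerminals.isChosen_u X)) _ _
    · intro X Y g
      refine heq_of_proj ?_ ?_ ?_
      · exact mk_eq_unit (f.pres _ (LocalTerminals.isChosen_u X)) _ _
      · exact mk_eq_unit (f.pres _ (LocalTerminals.isChosen_u Y)) _ _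
      · refine heq_of_eq ((proj_unitFunctor_map (A := B) (f.F.map g)).trans ?_)
        refine Eq.trans ?_ (proj_mapFunctor_map f.toHom ((unitFunctor A).map g)).symm
        exact congrArg f.F.map (proj_unitFunctor_map g).symm
    · intro X x
      refine (eqToHom_toFun_val (card_τ (A := B) (f.F.obj X)) _).trans ?_
      have h1 := incl_of_isChosen (f.pres _ (LocalTerminals.isChosen_u X)) (f.F.map (A.lt.τ X))
        ((f.ν.app _).toFun (star X))
        ((mapν f.toHom ((unitFunctor A).obj X)).toFun ((eqToHom (card_τ X)).toFun x))
      refine Eq.trans ?_ h1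
      refine congrArg Fin.val (Eq.trans ?_
        (incl_mapν f.toHom ((unitFunctor A).obj X) ((eqToHom (card_τ X)).toFun x)).symm)
      refine congrArg (f.ν.app X).toFun (Fin.ext ?_)
      exact ((incl_of_isChosen (LocalTerminals.isChosen_u X) _ _ _).trans
        (eqToHom_toFun_val (card_τ X) x)).symm

/-- The forgetful--cofree adjunction between `Cat_ℓt // 𝒮` (the category of coalgebras for the
modified décalage comonad on `Cat // 𝒮`) and `Cat // 𝒮`. -/
def adj : CatLtOverS.forget.{u} ⊣ cofree.{u} :=
  Adjunction.mkOfUnitCounit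
    { unit := unit
      counit := counit
      left_triangle := by
        ext A : 2
        refine CatOverS.Hom.ext (fun _ => rfl) ?_ ?_
        · intro X Y f
          exact heq_of_eq (proj_unitFunctor_map f)
        · intro X x
          exact (incl_of_isChosen (A := A) (LocalTerminals.isChosen_u X) _ _ _).trans
            (eqToHom_toFun_val (card_τ X) x)
      right_triangle := by
        ext A : 2
        have hobj : ∀ a : Obj A, (mapFunctor (counit.app A)).obj
            ((unitFunctor (cofreeObj A)).obj a) = a := by
          rintro ⟨⟨X, i⟩, a⟩
          have hτ : (lt A).τ ⟨⟨X, i⟩, a⟩ = ((Sigma.incl (C := fun p :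
              (Σ X : A.C, Fin (A.card.obj X).size) => Over p.1) ⟨X, i⟩).map
                (Over.mkIdTerminal.from a) : (⟨⟨X, i⟩, a⟩ : Obj A) ⟶ mk X i (𝟙 X)) :=
            LocalTerminals.hom_ext (isChosen_mk_id X i) _ _
          have hi : ∀ k : Fin (fibre (A.card.map (𝟙 X)) i).size,
              (incl (A.card.map (𝟙 X)) i).toFun k = i := fun k => by
            have h1 : ∀ z, (A.card.map (𝟙 X)).toFun z = z := fun z => by
              rw [A.card.map_id]; rfl
            exact (h1 _).symm.trans (incl_prop (A.card.map (𝟙 X)) i k)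
          refine mk_congr (f' := a.hom) rfl (congrArg Fin.val (hi _)) rfl (heq_of_eq ?_)
          have h2 : (proj A).map ((lt A).τ ⟨⟨X, i⟩, a⟩) = a.hom := by
            rw [hτ]
            have h3 := Over.w (Over.mkIdTerminal.from a)
            exact (Category.comp_id _).symm.trans h3
          exact h2
        refine CatLtOverS.hom_ext hobj ?_ ?_
        · intro a b f
          refine heq_of_proj (hobj a) (hobj b) (heq_of_eq ?_)
          refine (proj_mapFunctor_map (counit.app A)
            ((unitFunctor (cofreeObj A)).map f)).trans ?_
          exact congrArg (proj A).map (proj_unitFunctor_map (A := cofreeObj A) f)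
        · intro a x
          refine val_eq_of_incl (hobj a) _ _ ?_
          refine (congrArg Fin.val (incl_mapν (counit.app A) ((unitFunctor (cofreeObj A)).obj a)
            ((eqToHom (card_τ (A := cofreeObj A) a)).toFun x))).trans ?_
          refine congrArg (fun z => ((incl (A.card.map a.2.hom) a.1.2).toFun z : ℕ)) (Fin.ext ?_)
          exact (incl_of_isChosen (A := cofreeObj A) (LocalTerminals.isChosen_u a) _ _ _).trans
            (eqToHom_toFun_val (card_τ (A := cofreeObj A) a) x) }

end Dm

/-- The modified décalage monad on `Cat_ℓt // 𝒮`: the monad induced by the forgetful--cofree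
adjunction. -/
def modifiedDecalageMonad : Monad CatLtOverS.{u} := Dm.adj.toMonad

/-! ### Operadic and lax-operadic categories -/

open FinS

/-- The data common to operadic and lax-operadic categories: a small category with local terminal
objects, a cardinality functor to `𝒮` which sends chosen local terminals to `1`, and a functor
`φ_{X,i} : C/X ⥤ C` for each object `X` and each `i ∈ |X|`. -/
structure FibreData : Type (u + 1) extends CatLtOverS.{u} where
  /-- The fibre functors. -/
  fib : ∀ (X : C) (_ : Fin (card.obj X).size), Over X ⥤ C

namespace FibreData

variable (P : FibreData.{u}) {X Y Z : P.C}

/-- The fibre `f⁻¹(i)`. -/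
abbrev fibObj (f : Y ⟶ X) (i : Fin (P.card.obj X).size) : P.C := (P.fib X i).obj (Over.mk f)

/-- The fibre map `g^f_i : (fg)⁻¹(i) ⟶ f⁻¹(i)`. -/
abbrev fibMap (g : Z ⟶ Y) (f : Y ⟶ X) (i : Fin (P.card.obj X).size) :
    P.fibObj (g ≫ f) i ⟶ P.fibObj f i :=
  (P.fib X i).map (Over.homMk g)

/-- The fibre map `|g|^{|f|}_i : |fg|⁻¹(i) ⟶ |f|⁻¹(i)` in `𝒮`. -/
abbrev cardFibMap (g : Z ⟶ Y) (f : Y ⟶ X) (i : Fin (P.card.obj X).size) :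
    fibre (P.card.map (g ≫ f)) i ⟶ fibre (P.card.map f) i :=
  fibreMap (P.card.map (g ≫ f)) (P.card.map f) (P.card.map g) i i
    fun x hx => (comm_apply (P.card.map_comp g f).symm x).trans hx

end FibreData

/-- A lax-operadic category. Equality of maps whose domains and codomains are equal only
by previous clauses is expressed by `HEq`. -/
structure LaxOpCat : Type (u + 1) extends FibreData.{u} where
  /-- The relabelling functions `γ_{f,i} : |f|⁻¹(i) ⟶ |f⁻¹(i)|`. -/
  γ : ∀ {X Y : C} (f : Y ⟶ X) (i : Fin (card.obj X).size),
    fibre (card.map f) i ⟶ card.obj (toFibreData.fibObj f i)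
  /-- `(1_X)⁻¹(i)` is a chosen terminal. -/
  fibObj_id : ∀ (X : C) (i : Fin (card.obj X).size), lt.IsChosen (toFibreData.fibObj (𝟙 X) i)
  /-- `|g^f_i| ∘ γ_{fg,i} = γ_{f,i} ∘ |g|^{|f|}_i`. -/
  γ_fibMap : ∀ {X Y Z : C} (g : Z ⟶ Y) (f : Y ⟶ X) (i : Fin (card.obj X).size),
    γ (g ≫ f) i ≫ card.map (toFibreData.fibMap g f i) = toFibreData.cardFibMap g f i ≫ γ f i
  /-- `τ_X⁻¹(*) = X`. -/
  fibObj_τ : ∀ (X : C) (i : Fin (card.obj (lt.u X)).size), toFibreData.fibObj (lt.τ X) i = X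
  /-- `f^{τ_X}_* = f`. -/
  fibMap_τ : ∀ {X Y : C} (f : Y ⟶ X) (i : Fin (card.obj (lt.u X)).size),
    HEq (toFibreData.fibMap f (lt.τ X) i) f
  /-- The function `γ_{τ_X,*} : |X| = |τ_X|⁻¹(*) ⟶ |τ_X⁻¹(*)| = |X|` is the identity. -/
  γ_τ : ∀ (X : C) (i : Fin (card.obj (lt.u X)).size) (x : Fin (fibre (card.map (lt.τ X)) i).size),
    ((γ (lt.τ X) i).toFun x : ℕ) = x
  /-- `(g^f_i)⁻¹(γ j) = g⁻¹(ε j)`. -/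
  fibObj_fibMap : ∀ {X Y Z : C} (g : Z ⟶ Y) (f : Y ⟶ X) (i : Fin (card.obj X).size)
    (j : Fin (fibre (card.map f) i).size),
    toFibreData.fibObj (toFibreData.fibMap g f i) ((γ f i).toFun j) =
      toFibreData.fibObj g ((incl (card.map f) i).toFun j)
  /-- `γ_{g^f_i, γ j} ∘ γ̄_{fg,i} = γ_{g, ε j}`, modulo the equality
  `(|g|^{|f|}_i)⁻¹(j) = |g|⁻¹(ε j)`, where `γ̄_{fg,i} : (|g|^{|f|}_i)⁻¹(j) ⟶ |g^f_i|⁻¹(γ j)` is the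
  map of fibres induced by `γ_{fg,i}`. -/
  γ_γ : ∀ {X Y Z : C} (g : Z ⟶ Y) (f : Y ⟶ X) (i : Fin (card.obj X).size)
    (j : Fin (fibre (card.map f) i).size)
    (k : Fin (fibre (toFibreData.cardFibMap g f i) j).size),
    ((γ (toFibreData.fibMap g f i) ((γ f i).toFun j)).toFun
      ((fibreMap (toFibreData.cardFibMap g f i) (card.map (toFibreData.fibMap g f i))
        (γ (g ≫ f) i) j ((γ f i).toFun j)
        fun x hx => (comm_apply (γ_fibMap g f i) x).trans (congrArg (γ f i).toFun hx)).toFun k) :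
        ℕ) =
    (γ g ((incl (card.map f) i).toFun j)).toFun
      ((eqToHom (fibre_fibreMap _ _ _ (card.map_comp g f).symm i j)).toFun k)
  /-- `(h^{fg}_i)^{g^f_i}_{γ j} = h^g_{ε j}`. -/
  fibMap_fibMap : ∀ {X Y Z W : C} (h : W ⟶ Z) (g : Z ⟶ Y) (f : Y ⟶ X)
    (i : Fin (card.obj X).size) (j : Fin (fibre (card.map f) i).size),
    HEq (toFibreData.fibMap (toFibreData.fibMap h (g ≫ f) i) (toFibreData.fibMap g f i)
      ((γ f i).toFun j)) (toFibreData.fibMap h g ((incl (card.map f) i).toFun j))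

/-- An operadic category. Equality of maps whose domains and codomains are equal only
by previous clauses is expressed by `HEq`. -/
structure OpCat : Type (u + 1) extends FibreData.{u} where
  /-- `(1_X)⁻¹(i)` is a chosen terminal. -/
  fibObj_id : ∀ (X : C) (i : Fin (card.obj X).size), lt.IsChosen (toFibreData.fibObj (𝟙 X) i)
  /-- `|f⁻¹(i)| = |f|⁻¹(i)`. -/
  card_fibObj : ∀ {X Y : C} (f : Y ⟶ X) (i : Fin (card.obj X).size),
    card.obj (toFibreData.fibObj f i) = fibre (card.map f) i
  /-- `|g^f_i| = |g|^{|f|}_i`. -/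
  card_fibMap : ∀ {X Y Z : C} (g : Z ⟶ Y) (f : Y ⟶ X) (i : Fin (card.obj X).size),
    HEq (card.map (toFibreData.fibMap g f i)) (toFibreData.cardFibMap g f i)
  /-- `τ_X⁻¹(*) = X`. -/
  fibObj_τ : ∀ (X : C) (i : Fin (card.obj (lt.u X)).size), toFibreData.fibObj (lt.τ X) i = X
  /-- `f^{τ_X}_* = f`. -/
  fibMap_τ : ∀ {X Y : C} (f : Y ⟶ X) (i : Fin (card.obj (lt.u X)).size),
    HEq (toFibreData.fibMap f (lt.τ X) i) f
  /-- `(g^f_i)⁻¹(j) = g⁻¹(ε j)`, for `j ∈ |f|⁻¹(i) = |f⁻¹(i)|`. -/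
  fibObj_fibMap : ∀ {X Y Z : C} (g : Z ⟶ Y) (f : Y ⟶ X) (i : Fin (card.obj X).size)
    (j : Fin (fibre (card.map f) i).size),
    toFibreData.fibObj (toFibreData.fibMap g f i) ((eqToHom (card_fibObj f i).symm).toFun j) =
      toFibreData.fibObj g ((incl (card.map f) i).toFun j)
  /-- `(h^{fg}_i)^{g^f_i}_j = h^g_{ε j}`. -/
  fibMap_fibMap : ∀ {X Y Z W : C} (h : W ⟶ Z) (g : Z ⟶ Y) (f : Y ⟶ X)
    (i : Fin (card.obj X).size) (j : Fin (fibre (card.map f) i).size),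
    HEq (toFibreData.fibMap (toFibreData.fibMap h (g ≫ f) i) (toFibreData.fibMap g f i)
      ((eqToHom (card_fibObj f i).symm).toFun j))
      (toFibreData.fibMap h g ((incl (card.map f) i).toFun j))

/-- A lax-operadic functor: a functor `F` preserving chosen local terminals, with a natural family
of functions `ν_X : |X| ⟶ |FX|`, compatible with fibres, fibre maps and relabelling functions. -/
structure LaxOpCat.Hom (L M : LaxOpCat.{u}) : Type u
    extends toLtHom : CatLtOverS.Hom L.toCatLtOverS M.toCatLtOverS where
  /-- `F(f⁻¹(i)) = (Ff)⁻¹(ν_X i)`. -/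
  map_fibObj : ∀ {X Y : L.C} (f : Y ⟶ X) (i : Fin (L.card.obj X).size),
    F.obj (L.fibObj f i) = M.fibObj (F.map f) ((ν.app X).toFun i)
  /-- `F(g^f_i) = (Fg)^{Ff}_{ν_X i}`. -/
  map_fibMap : ∀ {X Y Z : L.C} (g : Z ⟶ Y) (f : Y ⟶ X) (i : Fin (L.card.obj X).size),
    HEq (F.map (L.fibMap g f i)) (M.fibMap (F.map g) (F.map f) ((ν.app X).toFun i))
  /-- `ν_{f⁻¹(i)} ∘ γ_{f,i} = γ_{Ff, ν_X i} ∘ ν̄`, where `ν̄ : |f|⁻¹(i) ⟶ |Ff|⁻¹(ν_X i)` is the map of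
  fibres induced by `ν_Y`. -/
  map_γ : ∀ {X Y : L.C} (f : Y ⟶ X) (i : Fin (L.card.obj X).size)
    (x : Fin (fibre (L.card.map f) i).size),
    ((ν.app (L.fibObj f i)).toFun ((L.γ f i).toFun x) : ℕ) =
      (M.γ (F.map f) ((ν.app X).toFun i)).toFun
        ((fibreMap (L.card.map f) (M.card.map (F.map f)) (ν.app Y) i ((ν.app X).toFun i)
          fun y hy => (comm_apply (ν.naturality f).symm y).trans
            (congrArg (ν.app X).toFun hy)).toFun x)

/-- An operadic functor: a functor which preserves chosen local terminals, commutes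
strictly with the cardinality functors, and preserves fibres and fibre maps. -/
structure OpCat.Hom (O P : OpCat.{u}) : Type u where
  /-- The underlying functor. -/
  F : O.C ⥤ P.C
  /-- Chosen local terminals are preserved. -/
  pres : ∀ X, O.lt.IsChosen X → P.lt.IsChosen (F.obj X)
  /-- The functor commutes with cardinalities. -/
  card_comp : O.card = F ⋙ P.card
  /-- `F(f⁻¹(i)) = (Ff)⁻¹(i)`, for `i ∈ |X| = |FX|`. -/
  map_fibObj : ∀ {X Y : O.C} (f : Y ⟶ X) (i : Fin (O.card.obj X).size),
    F.obj (O.fibObj f i) =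
      P.fibObj (F.map f) ((eqToHom (Functor.congr_obj card_comp X)).toFun i)
  /-- `F(g^f_i) = (Fg)^{Ff}_i`. -/
  map_fibMap : ∀ {X Y Z : O.C} (g : Z ⟶ Y) (f : Y ⟶ X) (i : Fin (O.card.obj X).size),
    HEq (F.map (O.fibMap g f i))
      (P.fibMap (F.map g) (F.map f) ((eqToHom (Functor.congr_obj card_comp X)).toFun i))

/-! ### Algebras for the modified décalage monad as lax-operadic categories -/

namespace Dm

theorem heq_map {C D : Type u} [SmallCategory C] [SmallCategory D] (F : C ⥤ D) {X Y X' Y' : C}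
    (hX : X = X') (hY : Y = Y') {f : X ⟶ Y} {g : X' ⟶ Y'} (h : HEq f g) :
    HEq (F.map f) (F.map g) := by
  subst hX hY
  exact heq_of_eq (congrArg F.map (eq_of_heq h))

section

variable {A : CatOverS.{u}}

/-- Every map of `D_m(C)` with target `(X, i, f)` is of the form `g : (X, i, fg) ⟶ (X, i, f)`. -/
theorem hom_cases {X : A.C} {i : Fin (A.card.obj X).size} {Y : A.C} {f : Y ⟶ X}
    {motive : ∀ V : Obj A, (V ⟶ mk X i f) → Prop}
    (h : ∀ (Z : A.C) (g : Z ⟶ Y), motive (mk X i (g ≫ f)) (mkMap X i g f))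
    (V : Obj A) (k : V ⟶ mk X i f) : motive V k := by
  obtain ⟨p, a⟩ := V
  obtain ⟨k⟩ := k
  obtain ⟨Z, ⟨⟨⟩⟩, a⟩ := a
  obtain ⟨g, hg, rfl⟩ : ∃ (g : Z ⟶ Y) (hg : g ≫ f = a), k = Over.homMk g hg :=
    ⟨k.left, Over.w k, rfl⟩
  subst hg
  exact h Z g

end

theorem natTrans_val {C : Type u} [SmallCategory C] {F G : C ⥤ FinS} (α : F ⟶ G) {a b : C}
    (h : a = b) {x : Fin (F.obj a).size} {y : Fin (F.obj b).size} (hxy : (x : ℕ) = y) :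
    ((α.app a).toFun x : ℕ) = (α.app b).toFun y := by
  subst h
  rw [Fin.ext hxy]

/-- A strictly monotone function between sets of the same size is the identity. -/
theorem val_of_strictMono {m n : ℕ} (h : m = n) (f : Fin m → Fin n) (hf : StrictMono f)
    (x : Fin m) : (f x : ℕ) = x := by
  subst h
  have := (hf.range_inj strictMono_id).mp (by
    rw [(Finite.injective_iff_surjective.mp hf.injective).range_eq, Set.range_id])
  rw [this]
  rfl

theorem incl_strictMono {m n : FinS} (φ : m ⟶ n) (i : Fin n.size) :
    StrictMono (incl φ i).toFun := ((fibreSet φ i).orderEmbOfFin rfl).strictMono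

end Dm

namespace FibreData

variable (P : FibreData.{u})

/-- The copairing `D_m(C) ⥤ C` of the fibre functors. -/
def φ : Dm.Obj P.toCatOverS ⥤ P.C := Sigma.desc fun p => P.fib p.1 p.2

end FibreData

section structureMaps

variable {P Q : FibreData.{u}} (a : Dm.cofreeObj P.toCatOverS ⟶ P.toCatLtOverS)
  (b : Dm.cofreeObj Q.toCatOverS ⟶ Q.toCatLtOverS)

open Dm

theorem unit_iff (ha : a.F = P.φ) :
    unit.app P.toCatLtOverS ≫ a = 𝟙 P.toCatLtOverS ↔
      (∀ (X : P.C) (i : Fin (P.card.obj (P.lt.u X)).size), P.fibObj (P.lt.τ X) i = X) ∧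
      (∀ {X Y : P.C} (f : Y ⟶ X) (i : Fin (P.card.obj (P.lt.u X)).size),
        HEq (P.fibMap f (P.lt.τ X) i) f) ∧
      (∀ (X : P.C) (i : Fin (P.card.obj (P.lt.u X)).size)
        (x : Fin (fibre (P.card.map (P.lt.τ X)) i).size),
        ((a.ν.app (mk (P.lt.u X) i (P.lt.τ X))).toFun x : ℕ) = x) := by
  obtain ⟨⟨F, γ⟩, pres⟩ := a
  dsimp only at ha
  subst ha
  have hobj : ∀ (X : P.C) (i : Fin (P.card.obj (P.lt.u X)).size),
      (unitFunctor P.toCatLtOverS).obj X = mk (P.lt.u X) i (P.lt.τ X) := fun X i =>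
    mk_eq_unit (LocalTerminals.isChosen_u X) i _
  have hmap : ∀ {X Y : P.C} (f : Y ⟶ X) (i : Fin (P.card.obj (P.lt.u X)).size),
      HEq (P.φ.map ((unitFunctor P.toCatLtOverS).map f)) (P.fibMap f (P.lt.τ X) i) := by
    intro X Y f i
    have h1 := mk_eq_unit (A := P.toCatLtOverS) (LocalTerminals.isChosen_u X) i (f ≫ P.lt.τ X)
    refine heq_map P.φ (g := mkMap (A := P.toCatOverS) (P.lt.u X) i f (P.lt.τ X)) h1 (hobj X i) ?_
    exact heq_of_proj h1 (hobj X i) (heq_of_eq (proj_unitFunctor_map f))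
  constructor
  · intro h
    have h1 : ∀ X : P.C, P.φ.obj ((unitFunctor P.toCatLtOverS).obj X) = X := fun X =>
      congrArg (fun m : P.toCatLtOverS ⟶ P.toCatLtOverS => m.F.obj X) h
    have h2 : ∀ {X Y : P.C} (f : Y ⟶ X), HEq (P.φ.map ((unitFunctor P.toCatLtOverS).map f)) f :=
      fun f => congr_arg_heq (fun m : P.toCatLtOverS ⟶ P.toCatLtOverS => m.F.map f) h
    have h3 : ∀ (X : P.C) (x : Fin (P.card.obj X).size),
        ((γ.app ((unitFunctor P.toCatLtOverS).obj X)).toFun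
          ((eqToHom (card_τ (A := P.toCatLtOverS) X)).toFun x) : ℕ) = x := fun X x =>
      congrArg (fun m : P.toCatLtOverS ⟶ P.toCatLtOverS => ((m.ν.app X).toFun x : ℕ)) h
    refine ⟨fun X i => (congrArg P.φ.obj (hobj X i)).symm.trans (h1 X),
      fun f i => (hmap f i).symm.trans (h2 f), fun X i x => ?_⟩
    have hX : P.card.obj X = fibre (P.card.map (P.lt.τ X)) i := by
      rw [star_val (A := P.toCatLtOverS) i]
      exact card_τ (A := P.toCatLtOverS) X
    refine Eq.trans ?_ ((h3 X (Fin.cast (congrArg FinS.size hX).symm x)).trans rfl)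
    refine natTrans_val γ (hobj X i).symm ?_
    exact (eqToHom_toFun_val (card_τ (A := P.toCatLtOverS) X)
      (Fin.cast (congrArg FinS.size hX).symm x)).symm
  · rintro ⟨h1, h2, h3⟩
    refine CatLtOverS.hom_ext (fun X => h1 X (star X))
      (fun X Y f => (hmap f (star Y)).trans (h2 f _)) (fun X x => ?_)
    exact (h3 X (star X) _).trans (eqToHom_toFun_val (card_τ (A := P.toCatLtOverS) X) x)

/-- The map `(|g|^{|f|}_i)⁻¹(j) ⟶ |g|⁻¹(ε j)` underlying the multiplication is monotone,
hence the identity. -/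
theorem mult_val {X Y Z : P.C} (g : Z ⟶ Y) (f : Y ⟶ X) (i : Fin (P.card.obj X).size)
    (j : Fin (fibre (P.card.map f) i).size) (k : Fin (fibre (P.cardFibMap g f i) j).size) :
    ((mapν (counit.app P.toCatOverS) (mk (A := toOverS P.toCatOverS) (mk X i f) j
      (mkMap X i g f))).toFun k : ℕ) = k := by
  refine val_of_strictMono (congrArg FinS.size
    (fibre_fibreMap (P.card.map g) (P.card.map f) _ (P.card.map_comp g f).symm i j)) _ ?_ k
  intro k k' hk
  have h := fun z => incl_mapν (counit.app P.toCatOverS)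
    (mk (A := toOverS P.toCatOverS) (mk X i f) j (mkMap X i g f)) z
  refine (incl_strictMono (P.card.map g) ((incl (P.card.map f) i).toFun j)).lt_iff_lt.mp ?_
  refine (lt_of_eq_of_lt (h k) (lt_of_lt_of_eq ?_ (h k').symm))
  exact incl_strictMono (P.card.map (g ≫ f)) i (incl_strictMono (P.cardFibMap g f i) j hk)

theorem assoc_iff (γ : Dm.card P.toCatOverS ⟶ P.φ ⋙ P.card)
    (pres : ∀ X, (Dm.lt P.toCatOverS).IsChosen X → P.lt.IsChosen (P.φ.obj X))
    (a : cofreeObj P.toCatOverS ⟶ P.toCatLtOverS) (ha : a = ⟨⟨P.φ, γ⟩, pres⟩)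
    (γ_fibMap : ∀ {X Y Z : P.C} (g : Z ⟶ Y) (f : Y ⟶ X) (i : Fin (P.card.obj X).size),
      γ.app (mk X i (g ≫ f)) ≫ P.card.map (P.fibMap g f i) =
        P.cardFibMap g f i ≫ γ.app (mk X i f)) :
    cofreeMap (counit.app P.toCatOverS) ≫ a = cofreeMap a.toHom ≫ a ↔
      (∀ {X Y Z : P.C} (g : Z ⟶ Y) (f : Y ⟶ X) (i : Fin (P.card.obj X).size)
        (j : Fin (fibre (P.card.map f) i).size),
        P.fibObj (P.fibMap g f i) ((γ.app (mk X i f)).toFun j) =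
          P.fibObj g ((incl (P.card.map f) i).toFun j)) ∧
      (∀ {X Y Z : P.C} (g : Z ⟶ Y) (f : Y ⟶ X) (i : Fin (P.card.obj X).size)
        (j : Fin (fibre (P.card.map f) i).size) (k : Fin (fibre (P.cardFibMap g f i) j).size),
        ((γ.app (mk _ ((γ.app (mk X i f)).toFun j) (P.fibMap g f i))).toFun
          ((fibreMap (P.cardFibMap g f i) (P.card.map (P.fibMap g f i))
            (γ.app (mk X i (g ≫ f))) j ((γ.app (mk X i f)).toFun j)
            fun x hx => (comm_apply (γ_fibMap g f i) x).trans
              (congrArg (γ.app (mk X i f)).toFun hx)).toFun k) : ℕ) =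
        (γ.app (mk Y ((incl (P.card.map f) i).toFun j) g)).toFun
          ((eqToHom (fibre_fibreMap _ _ _ (P.card.map_comp g f).symm i j)).toFun k)) ∧
      (∀ {X Y Z W : P.C} (h : W ⟶ Z) (g : Z ⟶ Y) (f : Y ⟶ X)
        (i : Fin (P.card.obj X).size) (j : Fin (fibre (P.card.map f) i).size),
        HEq (P.fibMap (P.fibMap h (g ≫ f) i) (P.fibMap g f i) ((γ.app (mk X i f)).toFun j))
          (P.fibMap h g ((incl (P.card.map f) i).toFun j))) := by
  subst ha
  -- the two sides on a canonical morphism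
  have hL : ∀ {X Y Z W : P.C} (h : W ⟶ Z) (g : Z ⟶ Y) (f : Y ⟶ X)
      (i : Fin (P.card.obj X).size) (j : Fin (fibre (P.card.map f) i).size),
      HEq (P.φ.map ((mapFunctor (counit.app P.toCatOverS)).map
        (mkMap (A := toOverS P.toCatOverS) (mk X i f) j (mkMap X i h (g ≫ f)) (mkMap X i g f))))
        (P.fibMap h g ((incl (P.card.map f) i).toFun j)) := fun _ _ _ _ _ => HEq.rfl
  have hR : ∀ {X Y Z W : P.C} (h : W ⟶ Z) (g : Z ⟶ Y) (f : Y ⟶ X)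
      (i : Fin (P.card.obj X).size) (j : Fin (fibre (P.card.map f) i).size),
      HEq (P.φ.map ((mapFunctor (A := toOverS P.toCatOverS) (B := P.toCatOverS) ⟨P.φ, γ⟩).map
        (mkMap (A := toOverS P.toCatOverS) (mk X i f) j (mkMap X i h (g ≫ f)) (mkMap X i g f))))
        (P.fibMap (P.fibMap h (g ≫ f) i) (P.fibMap g f i) ((γ.app (mk X i f)).toFun j)) := by
    intro X Y Z W h g f i j
    have e : (mapFunctor (A := toOverS P.toCatOverS) (B := P.toCatOverS) ⟨P.φ, γ⟩).obj
        (mk (A := toOverS P.toCatOverS) (mk X i f) j (mkMap X i h (g ≫ f) ≫ mkMap X i g f)) =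
        mk (P.fibObj f i) ((γ.app (mk X i f)).toFun j)
          (P.fibMap h (g ≫ f) i ≫ P.fibMap g f i) :=
      mk_congr rfl rfl rfl (heq_of_eq (P.φ.map_comp (mkMap X i h (g ≫ f)) (mkMap X i g f)))
    refine heq_map P.φ (g := mkMap (P.fibObj f i) ((γ.app (mk X i f)).toFun j)
      (P.fibMap h (g ≫ f) i) (P.fibMap g f i)) e rfl ?_
    exact heq_of_proj e rfl HEq.rfl
  have hν : ∀ {X Y Z : P.C} (g : Z ⟶ Y) (f : Y ⟶ X) (i : Fin (P.card.obj X).size)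
        (j : Fin (fibre (P.card.map f) i).size) (k : Fin (fibre (P.cardFibMap g f i) j).size),
      ((γ.app (mk Y ((incl (P.card.map f) i).toFun j) g)).toFun
        ((mapν (counit.app P.toCatOverS) (mk (A := toOverS P.toCatOverS) (mk X i f) j
          (mkMap X i g f))).toFun k) : ℕ) =
      (γ.app (mk Y ((incl (P.card.map f) i).toFun j) g)).toFun
          ((eqToHom (fibre_fibreMap _ _ _ (P.card.map_comp g f).symm i j)).toFun k) := by
    intro X Y Z g f i j k
    refine natTrans_val γ rfl ((mult_val g f i j k).trans ?_)
    exact (eqToHom_toFun_val _ k).symm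
  constructor
  · intro h
    refine ⟨fun {X Y Z} g f i j => ?_, fun {X Y Z} g f i j k => ?_,
      fun {X Y Z W} h' g f i j => ?_⟩
    · exact (congrArg (fun m : cofreeObj (toOverS P.toCatOverS) ⟶ P.toCatLtOverS => m.F.obj
        (mk (A := toOverS P.toCatOverS) (mk X i f) j (mkMap X i g f))) h).symm
    · refine Eq.trans ?_ (hν g f i j k)
      exact (congrArg (fun m : cofreeObj (toOverS P.toCatOverS) ⟶ P.toCatLtOverS =>
        ((m.ν.app (mk (A := toOverS P.toCatOverS) (mk X i f) j (mkMap X i g f))).toFun k : ℕ))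
          h).symm
    · refine (hR h' g f i j).symm.trans (HEq.trans ?_ (hL h' g f i j))
      exact (congr_arg_heq (fun m : cofreeObj (toOverS P.toCatOverS) ⟶ P.toCatLtOverS => m.F.map
        (mkMap (A := toOverS P.toCatOverS) (mk X i f) j (mkMap X i h' (g ≫ f)) (mkMap X i g f)))
          h).symm
  · rintro ⟨h1, h2, h3⟩
    have obj_cases : ∀ {motive : Obj (toOverS P.toCatOverS) → Prop}
        (_ : ∀ {X Y Z : P.C} (g : Z ⟶ Y) (f : Y ⟶ X) (i : Fin (P.card.obj X).size)
          (j : Fin (fibre (P.card.map f) i).size),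
          motive (mk (A := toOverS P.toCatOverS) (mk X i f) j (mkMap X i g f))) (a), motive a := by
      rintro motive h ⟨⟨⟨⟨X, i⟩, ⟨Y, ⟨⟨⟩⟩, f⟩⟩, j⟩, ⟨V, ⟨⟨⟩⟩, g⟩⟩
      exact hom_cases (motive := fun V g => motive
        (mk (A := toOverS P.toCatOverS) (mk X i f) j g)) (fun Z g => h g f i j) V g
    refine CatLtOverS.hom_ext ?_ ?_ ?_
    · exact fun a => obj_cases (motive := fun a => P.φ.obj
        ((mapFunctor (counit.app P.toCatOverS)).obj a) = P.φ.obj ((mapFunctor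
          (A := toOverS P.toCatOverS) (B := P.toCatOverS) ⟨P.φ, γ⟩).obj a))
        (fun g f i j => (h1 g f i j).symm) a
    · intro a b
      refine obj_cases (motive := fun b => ∀ k : a ⟶ b, HEq (P.φ.map
        ((mapFunctor (counit.app P.toCatOverS)).map k)) (P.φ.map ((mapFunctor
          (A := toOverS P.toCatOverS) (B := P.toCatOverS) ⟨P.φ, γ⟩).map k))) ?_ b
      intro X Y Z g f i j k
      refine hom_cases (A := toOverS P.toCatOverS) (motive := fun a k => HEq (P.φ.map
        ((mapFunctor (counit.app P.toCatOverS)).map k)) (P.φ.map ((mapFunctor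
          (A := toOverS P.toCatOverS) (B := P.toCatOverS) ⟨P.φ, γ⟩).map k))) ?_ a k
      intro V k
      refine hom_cases (motive := fun V k => HEq (P.φ.map
        ((mapFunctor (counit.app P.toCatOverS)).map (mkMap (A := toOverS P.toCatOverS)
          (mk X i f) j k (mkMap X i g f)))) (P.φ.map ((mapFunctor
          (A := toOverS P.toCatOverS) (B := P.toCatOverS) ⟨P.φ, γ⟩).map
          (mkMap (A := toOverS P.toCatOverS) (mk X i f) j k (mkMap X i g f))))) ?_ V k
      intro W h
      exact (hL h g f i j).trans ((h3 h g f i j).symm.trans (hR h g f i j).symm)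
    · exact fun a => obj_cases (motive := fun a => ∀ x : Fin ((Dm.card (toOverS P.toCatOverS)).obj
        a).size, ((γ.app ((mapFunctor (counit.app P.toCatOverS)).obj a)).toFun
          ((mapν (counit.app P.toCatOverS) a).toFun x) : ℕ) =
        ((γ.app ((mapFunctor (A := toOverS P.toCatOverS) (B := P.toCatOverS) ⟨P.φ, γ⟩).obj
          a)).toFun ((mapν (A := toOverS P.toCatOverS) (B := P.toCatOverS) ⟨P.φ, γ⟩ a).toFun x)))
        (fun g f i j k => (hν g f i j k).trans (h2 g f i j k).symm) a

theorem hom_iff (m : P.toCatLtOverS ⟶ Q.toCatLtOverS) :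
    cofreeMap m.toHom ≫ b = a ≫ m ↔
      (∀ {X Y : P.C} (f : Y ⟶ X) (i : Fin (P.card.obj X).size),
        m.F.obj (a.F.obj (mk X i f)) = b.F.obj (mk _ ((m.ν.app X).toFun i) (m.F.map f))) ∧
      (∀ {X Y Z : P.C} (g : Z ⟶ Y) (f : Y ⟶ X) (i : Fin (P.card.obj X).size),
        HEq (m.F.map (a.F.map (mkMap X i g f)))
          (b.F.map (mkMap _ ((m.ν.app X).toFun i) (m.F.map g) (m.F.map f)))) ∧
      (∀ {X Y : P.C} (f : Y ⟶ X) (i : Fin (P.card.obj X).size)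
        (x : Fin (fibre (P.card.map f) i).size),
        ((m.ν.app (a.F.obj (mk X i f))).toFun ((a.ν.app (mk X i f)).toFun x) : ℕ) =
          (b.ν.app (mk _ ((m.ν.app X).toFun i) (m.F.map f))).toFun
            ((mapν m.toHom (mk X i f)).toFun x)) := by
  have hmap : ∀ {X Y Z : P.C} (g : Z ⟶ Y) (f : Y ⟶ X) (i : Fin (P.card.obj X).size),
      HEq (b.F.map ((mapFunctor m.toHom).map (mkMap X i g f)))
        (b.F.map (mkMap _ ((m.ν.app X).toFun i) (m.F.map g) (m.F.map f))) := by
    intro X Y Z g f i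
    have e : (mapFunctor m.toHom).obj (mk X i (g ≫ f)) =
        mk _ ((m.ν.app X).toFun i) (m.F.map g ≫ m.F.map f) :=
      mk_congr rfl rfl rfl (heq_of_eq (m.F.map_comp g f))
    exact heq_map b.F e rfl (heq_of_proj e rfl HEq.rfl)
  constructor
  · intro h
    refine ⟨fun f i => ?_, fun g f i => ?_, fun f i x => ?_⟩
    · exact (congrArg (fun m : cofreeObj P.toCatOverS ⟶ Q.toCatLtOverS =>
        m.F.obj (mk _ i f)) h).symm
    · exact (congr_arg_heq (fun m : cofreeObj P.toCatOverS ⟶ Q.toCatLtOverS =>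
        m.F.map (mkMap _ i g f)) h).symm.trans (hmap g f i)
    · exact (congrArg (fun m : cofreeObj P.toCatOverS ⟶ Q.toCatLtOverS =>
        ((m.ν.app (mk _ i f)).toFun x : ℕ)) h).symm
  · rintro ⟨h1, h2, h3⟩
    refine CatLtOverS.hom_ext ?_ ?_ ?_
    · rintro ⟨⟨X, i⟩, ⟨Y, ⟨⟨⟩⟩, f⟩⟩
      exact (h1 f i).symm
    · rintro V ⟨⟨X, i⟩, ⟨Y, ⟨⟨⟩⟩, f⟩⟩ k
      refine hom_cases (motive := fun V k => HEq (b.F.map ((mapFunctor m.toHom).map k))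
        (m.F.map (a.F.map k))) ?_ V k
      intro Z g
      exact (hmap g f i).trans (h2 g f i).symm
    · rintro ⟨⟨X, i⟩, ⟨Y, ⟨⟨⟩⟩, f⟩⟩ x
      exact (h3 f i x).symm

end structureMaps

/-- The structure map `(φ, γ)` of the algebra associated to a lax-operadic category. -/
def LaxOpCat.str (L : LaxOpCat.{u}) : Dm.cofreeObj L.toCatOverS ⟶ L.toCatLtOverS where
  F := L.φ
  ν :=
    { app := fun a => L.γ a.2.hom a.1.2
      naturality := by
        rintro V ⟨⟨X, i⟩, ⟨Y, ⟨⟨⟩⟩, f⟩⟩ k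
        refine Dm.hom_cases (motive := fun V k => (Dm.card L.toCatOverS).map k ≫ L.γ f i =
          L.γ V.2.hom V.1.2 ≫ L.card.map (L.φ.map k)) ?_ V k
        intro Z g
        exact (L.γ_fibMap g f i).symm }
  pres a h := by
    obtain ⟨X, i, rfl⟩ := Dm.isChosen_iff.mp h
    exact L.fibObj_id X i

/-- The algebra associated to a lax-operadic category: its structure map is given by the fibres
and the relabelling functions. -/
def LaxOpCat.toAlgebra (L : LaxOpCat.{u}) : modifiedDecalageMonad.{u}.Algebra where
  A := L.toCatLtOverS
  a := L.str
  unit := (unit_iff L.str rfl).mpr ⟨L.fibObj_τ, L.fibMap_τ, L.γ_τ⟩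
  assoc := (assoc_iff L.str.ν L.str.pres L.str rfl L.γ_fibMap).mpr
    ⟨L.fibObj_fibMap, L.γ_γ, L.fibMap_fibMap⟩

/-- The lax-operadic category associated to an algebra: the fibres are given by the functor
part of the structure map, and the relabelling functions by its natural transformation part. -/
def algebraToLax (A : modifiedDecalageMonad.{u}.Algebra) : LaxOpCat.{u} :=
  let a : Dm.cofreeObj A.A.toCatOverS ⟶ A.A := A.a
  let P : FibreData.{u} :=
    { toCatLtOverS := A.A
      fib := fun X i => Sigma.incl
        (C := fun p : (Σ X : A.A.C, Fin (A.A.card.obj X).size) => Over p.1) ⟨X, i⟩ ⋙ a.F }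
  have hF : a.F = P.φ := Functor.hext (fun _ => rfl) (by rintro ⟨p, a⟩ ⟨_, b⟩ ⟨f⟩; rfl)
  have hn : ∀ {X Y Z : P.C} (g : Z ⟶ Y) (f : Y ⟶ X) (i : Fin (P.card.obj X).size),
      a.ν.app (Dm.mk X i (g ≫ f)) ≫ P.card.map (P.fibMap g f i) =
        P.cardFibMap g f i ≫ a.ν.app (Dm.mk X i f) :=
    fun g f i => (a.ν.naturality (Dm.mkMap _ i g f)).symm
  have hu := (unit_iff a hF).mp A.unit
  let γ' : Dm.card P.toCatOverS ⟶ P.φ ⋙ P.card :=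
    { app := a.ν.app
      naturality := by
        rintro ⟨p, V⟩ ⟨_, W⟩ ⟨k⟩
        exact a.ν.naturality (Sigma.SigmaHom.mk k) }
  have ha' : a = ⟨⟨P.φ, γ'⟩, a.pres⟩ := CatLtOverS.hom_ext (fun _ => rfl)
    (by rintro ⟨p, V⟩ ⟨_, W⟩ ⟨k⟩; rfl) (fun _ _ => rfl)
  have ha := (assoc_iff (P := P) γ' a.pres a ha' hn).mp A.assoc
  { toFibreData := P
    γ := fun f i => a.ν.app (Dm.mk _ i f)
    fibObj_id := fun X i => a.pres _ (Dm.isChosen_mk_id X i)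
    γ_fibMap := hn
    fibObj_τ := hu.1
    fibMap_τ := hu.2.1
    γ_τ := hu.2.2
    fibObj_fibMap := ha.1
    γ_γ := ha.2.1
    fibMap_fibMap := ha.2.2 }

namespace LaxOpCat

theorem Hom.ext' {L M : LaxOpCat.{u}} {f g : Hom L M} (h : f.toLtHom = g.toLtHom) : f = g := by
  cases f; cases g; congr

/-- The algebra map given by a lax-operadic functor. -/
def Hom.toAlgebraHom {L M : LaxOpCat.{u}} (f : Hom L M) : L.toAlgebra ⟶ M.toAlgebra where
  f := f.toLtHom
  h := (hom_iff L.str M.str f.toLtHom).mpr ⟨f.map_fibObj, f.map_fibMap, f.map_γ⟩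

/-- The lax-operadic functor given by an algebra map. -/
def homOfAlgebraHom {L M : LaxOpCat.{u}} (f : L.toAlgebra ⟶ M.toAlgebra) : Hom L M :=
  have h := (hom_iff L.str M.str f.f).mp f.h
  { toLtHom := f.f
    map_fibObj := h.1
    map_fibMap := h.2.1
    map_γ := h.2.2 }

instance : Category LaxOpCat.{u} where
  Hom := Hom
  id L :=
    { toLtHom := 𝟙 L.toCatLtOverS
      map_fibObj := (homOfAlgebraHom (𝟙 L.toAlgebra)).map_fibObj
      map_fibMap := (homOfAlgebraHom (𝟙 L.toAlgebra)).map_fibMap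
      map_γ := (homOfAlgebraHom (𝟙 L.toAlgebra)).map_γ }
  comp f g :=
    { toLtHom := CategoryStruct.comp (obj := CatLtOverS) f.toLtHom g.toLtHom
      map_fibObj := (homOfAlgebraHom (f.toAlgebraHom ≫ g.toAlgebraHom)).map_fibObj
      map_fibMap := (homOfAlgebraHom (f.toAlgebraHom ≫ g.toAlgebraHom)).map_fibMap
      map_γ := (homOfAlgebraHom (f.toAlgebraHom ≫ g.toAlgebraHom)).map_γ }
  id_comp f := Hom.ext' (Category.id_comp (obj := CatLtOverS) f.toLtHom)
  comp_id f := Hom.ext' (Category.comp_id (obj := CatLtOverS) f.toLtHom)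
  assoc f g h := Hom.ext' (Category.assoc (obj := CatLtOverS) f.toLtHom g.toLtHom
    h.toLtHom)

end LaxOpCat

/-- The functor from algebras to lax-operadic categories. -/
def algebraToLaxFunctor : modifiedDecalageMonad.{u}.Algebra ⥤ LaxOpCat.{u} where
  obj := algebraToLax
  map {A B} f :=
    have h := (hom_iff (P := (algebraToLax A).toFibreData) (Q := (algebraToLax B).toFibreData)
      A.a B.a f.f).mp f.h
    show LaxOpCat.Hom (algebraToLax A) (algebraToLax B) from
    { toLtHom := f.f
      map_fibObj := h.1
      map_fibMap := h.2.1
      map_γ := h.2.2 }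

/-- The functor from lax-operadic categories to algebras. -/
def laxToAlgebraFunctor : LaxOpCat.{u} ⥤ modifiedDecalageMonad.{u}.Algebra where
  obj := LaxOpCat.toAlgebra
  map f := LaxOpCat.Hom.toAlgebraHom f

theorem algebra_ext {A B : modifiedDecalageMonad.{u}.Algebra} (h : A.A = B.A)
    (ha : HEq A.a B.a) : A = B := by
  cases A; cases B
  dsimp only at h
  subst h
  cases ha
  rfl

theorem algebra_hom_heq {A B A' B' : modifiedDecalageMonad.{u}.Algebra} (hA : A = A') (hB : B = B')
    {f : A ⟶ B} {g : A' ⟶ B'} (h : HEq f.f g.f) : HEq f g := by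
  subst hA hB
  exact heq_of_eq (Monad.Algebra.Hom.ext (eq_of_heq h))

theorem toAlgebra_algebraToLax (A : modifiedDecalageMonad.{u}.Algebra) :
    (algebraToLax A).toAlgebra = A :=
  algebra_ext rfl (heq_of_eq (CatLtOverS.hom_ext (fun _ => rfl)
    (by rintro ⟨p, V⟩ ⟨_, W⟩ ⟨k⟩; rfl) (fun _ _ => rfl)))

/-- The isomorphism between the category of algebras for the modified décalage monad on
`Cat_ℓt // 𝒮` and the category of lax-operadic categories. -/
def algebraIso : Cat.of modifiedDecalageMonad.{u}.Algebra ≅ Cat.of LaxOpCat.{u} where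
  hom := algebraToLaxFunctor.toCatHom
  inv := laxToAlgebraFunctor.toCatHom
  hom_inv_id := Cat.ext (Functor.hext toAlgebra_algebraToLax fun A B _ =>
    algebra_hom_heq (toAlgebra_algebraToLax A) (toAlgebra_algebraToLax B) HEq.rfl)
  inv_hom_id := Cat.ext (Functor.hext (fun _ => rfl) fun _ _ _ => HEq.rfl)

/-! ### Operadic categories among lax-operadic categories -/

namespace FinS

theorem eqToHom_app_val {C : Type u} [SmallCategory C] {F G : C ⥤ FinS} (h : F = G) (X : C)
    (x : Fin (F.obj X).size) : (((eqToHom h).app X).toFun x : ℕ) = x := by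
  subst h; rfl

theorem fibre_congr {m n m' n' : FinS} {φ : m ⟶ n} {φ' : m' ⟶ n'} {i : Fin n.size}
    {i' : Fin n'.size} (hm : m = m') (hn : n = n') (hφ : HEq φ φ') (hi : (i : ℕ) = i') :
    fibre φ i = fibre φ' i' := by
  subst hm hn
  obtain rfl := eq_of_heq hφ
  rw [Fin.ext hi]

theorem comp_eqToHom_of_heq {m n m' n' : FinS} {φ : m ⟶ n} {φ' : m' ⟶ n'} (hm : m = m')
    (hn : n = n') (hφ : HEq φ φ') : eqToHom hm.symm ≫ φ = φ' ≫ eqToHom hn.symm := by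
  subst hm hn
  obtain rfl := eq_of_heq hφ
  rfl

/-- A map of fibres induced by an identity is an identity. -/
theorem fibreMap_val {m n m' n' : FinS} {φ : m ⟶ n} {φ' : m' ⟶ n'} {a : m ⟶ m'} {i : Fin n.size}
    {i' : Fin n'.size} (h : ∀ x, φ.toFun x = i → φ'.toFun (a.toFun x) = i')
    (e : fibre φ i = fibre φ' i') (ha : ∀ x, (a.toFun x : ℕ) = x) (x : Fin (fibre φ i).size) :
    ((fibreMap φ φ' a i i' h).toFun x : ℕ) = x := by
  refine Dm.val_of_strictMono (congrArg FinS.size e) _ (fun k l hkl => ?_) x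
  refine (Dm.incl_strictMono φ' i').lt_iff_lt.mp ?_
  rw [incl_fibreMap, incl_fibreMap]
  refine Fin.lt_def.mpr ?_
  rw [ha, ha]
  exact Dm.incl_strictMono φ i hkl

end FinS

namespace OpCat

/-- An operadic category is a lax-operadic category whose relabelling functions are the identities
`|f|⁻¹(i) = |f⁻¹(i)|`. -/
def toLax (O : OpCat.{u}) : LaxOpCat.{u} where
  toFibreData := O.toFibreData
  γ f i := eqToHom (O.card_fibObj f i).symm
  fibObj_id := O.fibObj_id
  γ_fibMap g f i := comp_eqToHom_of_heq (O.card_fibObj _ i) (O.card_fibObj f i)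
    (O.card_fibMap g f i)
  fibObj_τ := O.fibObj_τ
  fibMap_τ := O.fibMap_τ
  γ_τ X i x := eqToHom_toFun_val _ x
  fibObj_fibMap := O.fibObj_fibMap
  γ_γ g f i j k := by
    refine (eqToHom_toFun_val _ _).trans (Eq.trans ?_ (eqToHom_toFun_val _ _).symm)
    refine Eq.trans ?_ (eqToHom_toFun_val _ k).symm
    refine fibreMap_val _ ?_ (eqToHom_toFun_val _) k
    exact fibre_congr (O.card_fibObj _ _).symm (O.card_fibObj _ _).symm (O.card_fibMap g f i).symm
      (eqToHom_toFun_val _ j).symm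
  fibMap_fibMap := O.fibMap_fibMap

theorem Hom.ext' {O P : OpCat.{u}} {f g : Hom O P} (h : f.F = g.F) : f = g := by
  cases f; cases g; congr

theorem heq_fibMap {P : FibreData.{u}} {X Y Z : P.C} (g : Z ⟶ Y) (f : Y ⟶ X)
    {i i' : Fin (P.card.obj X).size} (h : i = i') : HEq (P.fibMap g f i) (P.fibMap g f i') := by
  subst h; rfl

instance : Category OpCat.{u} where
  Hom := Hom
  id O :=
    { F := 𝟭 O.C
      pres := fun _ h => h
      card_comp := rfl
      map_fibObj := fun _ _ => rfl
      map_fibMap := fun _ _ _ => HEq.rfl }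
  comp {O P Q} F G :=
    have hi : ∀ (X : O.C) (i : Fin (O.card.obj X).size),
        (eqToHom (Functor.congr_obj G.card_comp (F.F.obj X))).toFun
          ((eqToHom (Functor.congr_obj F.card_comp X)).toFun i) =
        (eqToHom (Functor.congr_obj (F.card_comp.trans
          (congrArg (F.F ⋙ ·) G.card_comp)) X)).toFun i := fun X i =>
      Fin.ext ((eqToHom_toFun_val _ _).trans
        ((eqToHom_toFun_val _ _).trans (eqToHom_toFun_val _ _).symm))
    { F := F.F ⋙ G.F
      pres := fun X h => G.pres _ (F.pres X h)
      card_comp := F.card_comp.trans (congrArg (F.F ⋙ ·) G.card_comp)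
      map_fibObj := fun f i => (congrArg G.F.obj (F.map_fibObj f i)).trans
        ((G.map_fibObj _ _).trans (congrArg (Q.fibObj _) (hi _ i)))
      map_fibMap := fun g f i =>
        (Dm.heq_map G.F ((F.map_fibObj _ i).trans (by rw [F.F.map_comp])) (F.map_fibObj f i)
          (F.map_fibMap g f i)).trans
        ((G.map_fibMap _ _ _).trans (heq_fibMap _ _ (hi _ i))) }
  id_comp _ := rfl
  comp_id _ := rfl
  assoc _ _ _ := rfl

/-- An operadic functor is a lax-operadic functor for which the functions
`ν_X : |X| ⟶ |FX|` are identities. -/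
def Hom.toLax {O P : OpCat.{u}} (F : Hom O P) : LaxOpCat.Hom O.toLax P.toLax where
  F := F.F
  ν := eqToHom F.card_comp
  pres := F.pres
  map_fibObj f i := (F.map_fibObj f i).trans (congrArg (P.fibObj _)
    (Fin.ext ((eqToHom_toFun_val _ i).trans (eqToHom_app_val F.card_comp _ i).symm)))
  map_fibMap g f i := (F.map_fibMap g f i).trans (heq_fibMap _ _
    (Fin.ext ((eqToHom_toFun_val _ i).trans (eqToHom_app_val F.card_comp _ i).symm)))
  map_γ {X Y} f i x := by
    refine (eqToHom_app_val F.card_comp _ _).trans ((eqToHom_toFun_val (O.card_fibObj f i).symm x).trans ?_)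
    refine Eq.trans ?_ (eqToHom_toFun_val (P.card_fibObj _ _).symm _).symm
    refine (fibreMap_val _ ?_ (eqToHom_app_val F.card_comp _) x).symm
    exact fibre_congr (Functor.congr_obj F.card_comp Y) (Functor.congr_obj F.card_comp X)
      (congr_arg_heq (fun K : O.C ⥤ FinS => K.map f) F.card_comp)
      (eqToHom_app_val F.card_comp X i).symm

/-- The inclusion of the category of operadic categories and operadic functors in the
category of lax-operadic categories and lax-operadic functors. -/
def inclusion : OpCat.{u} ⥤ LaxOpCat.{u} where
  obj := toLax
  map F := Hom.toLax F
  map_id _ := LaxOpCat.Hom.ext' (CatLtOverS.hom_ext (fun _ => rfl) (fun _ _ _ => HEq.rfl)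
    fun _ _ => rfl)
  map_comp F G := LaxOpCat.Hom.ext' (CatLtOverS.hom_ext (fun _ => rfl) (fun _ _ _ => HEq.rfl)
    fun X x => (eqToHom_app_val (Hom.card_comp (F ≫ G)) X x).trans (((eqToHom_app_val
      G.card_comp (F.F.obj X) _).trans
      (eqToHom_app_val F.card_comp X x)).symm))

end OpCat

end Decalage

end

/-!
The component at `(X, i, f)` of the natural transformation in the structure map of an algebra is the
relabelling function `γ_{f,i}`, and a natural transformation is an identity as soon as its
components are. So a strict structure map is the same as a lax-operadic category whose relabelling
functions are identities, and substituting `γ = 1` turns the lax axioms into the operadic ones. In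
the same way, substituting `ν = 1` turns the axioms of a lax-operadic functor into those of an
operadic functor.
-/

namespace Decalage

open FinS

theorem natTrans_eq_eqToHom_iff {C D : Type*} [Category* C] [Category* D] {F G : C ⥤ D}
    (α : F ⟶ G) :
    (∃ h : F = G, α = eqToHom h) ↔ ∀ X, ∃ h : F.obj X = G.obj X, α.app X = eqToHom h := by
  constructor
  · rintro ⟨rfl, rfl⟩ X
    exact ⟨rfl, rfl⟩
  · intro h
    choose hobj happ using h
    have hFG : F = G := CategoryTheory.Functor.ext hobj fun X Y g => by
      rw [← Category.assoc, ← happ X, ← α.naturality g, happ Y]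
      simp
    refine ⟨hFG, NatTrans.ext (funext fun X => ?_)⟩
    rw [happ X, eqToHom_app]

theorem CatLtOverS.isStrict_iff {A B : CatLtOverS.{u}} (f : A ⟶ B) :
    IsStrict f ↔
      ∀ X, ∃ h : A.card.obj X = B.card.obj (f.F.obj X), f.ν.app X = eqToHom h :=
  natTrans_eq_eqToHom_iff f.ν

namespace LaxOpCat

/-- A lax-operadic category has identity relabellings if `|f|⁻¹(i) = |f⁻¹(i)|` and `γ_{f,i}` is the
identity function, for all `f : Y ⟶ X` and `i ∈ |X|`. As the equality of objects of `𝒮` is only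
propositional, the identity is expressed by `eqToHom`. -/
def HasIdRelabelling (L : LaxOpCat.{u}) : Prop :=
  ∀ {X Y : L.C} (f : Y ⟶ X) (i : Fin (L.card.obj X).size),
    ∃ h : fibre (L.card.map f) i = L.card.obj (L.fibObj f i), L.γ f i = eqToHom h

variable {L : LaxOpCat.{u}}

theorem HasIdRelabelling.card_fibObj (hL : L.HasIdRelabelling) {X Y : L.C} (f : Y ⟶ X)
    (i : Fin (L.card.obj X).size) : L.card.obj (L.fibObj f i) = fibre (L.card.map f) i :=
  (hL f i).fst.symm

theorem HasIdRelabelling.γ_eq (hL : L.HasIdRelabelling) {X Y : L.C} (f : Y ⟶ X)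
    (i : Fin (L.card.obj X).size) : L.γ f i = eqToHom (hL.card_fibObj f i).symm :=
  (hL f i).snd

theorem HasIdRelabelling.card_fibMap (hL : L.HasIdRelabelling) {X Y Z : L.C} (g : Z ⟶ Y)
    (f : Y ⟶ X) (i : Fin (L.card.obj X).size) :
    HEq (L.card.map (L.fibMap g f i)) (L.cardFibMap g f i) := by
  have h := L.γ_fibMap g f i
  rw [hL.γ_eq, hL.γ_eq] at h
  exact (eqToHom_comp_heq_iff _ _ _).mp ((heq_comp_eqToHom_iff _ _ _).mp (heq_of_eq h))

/-- The operadic category underlying a lax-operadic category with identity relabellings. -/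
def HasIdRelabelling.toOpCat (hL : L.HasIdRelabelling) : OpCat.{u} where
  toFibreData := L.toFibreData
  fibObj_id := L.fibObj_id
  card_fibObj := hL.card_fibObj
  card_fibMap := hL.card_fibMap
  fibObj_τ := L.fibObj_τ
  fibMap_τ := L.fibMap_τ
  fibObj_fibMap g f i j := by
    rw [← hL.γ_eq]
    exact L.fibObj_fibMap g f i j
  fibMap_fibMap h g f i j := by
    rw [← hL.γ_eq]
    exact L.fibMap_fibMap h g f i j

theorem HasIdRelabelling.toLax_toOpCat (hL : L.HasIdRelabelling) : hL.toOpCat.toLax = L := by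
  obtain ⟨P, γ⟩ := L
  have hγ : @γ = fun X Y f i => eqToHom (hL.card_fibObj f i).symm := by
    funext X Y f i
    exact hL.γ_eq f i
  simp only [OpCat.toLax, toOpCat]
  congr 1
  exact hγ.symm

theorem hasIdRelabelling_toLax (O : OpCat.{u}) : O.toLax.HasIdRelabelling :=
  fun f i => ⟨(O.card_fibObj f i).symm, rfl⟩

theorem exists_eq_inclusion_obj_iff :
    (∃ O : OpCat.{u}, L = OpCat.inclusion.obj O) ↔ L.HasIdRelabelling := by
  constructor
  · rintro ⟨O, rfl⟩
    exact hasIdRelabelling_toLax O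
  · intro hL
    exact ⟨hL.toOpCat, hL.toLax_toOpCat.symm⟩

theorem hasIdRelabelling_algebraToLax_iff (A : modifiedDecalageMonad.{u}.Algebra) :
    (algebraToLax A).HasIdRelabelling ↔ CatLtOverS.IsStrict A.a := by
  rw [CatLtOverS.isStrict_iff]
  exact ⟨fun h a => h a.2.hom a.1.2, fun h _ _ f i => h (Dm.mk _ i f)⟩

/-- A lax-operadic functor is strict if its underlying map of `Cat_ℓt // 𝒮` is. -/
def Hom.IsStrict {L M : LaxOpCat.{u}} (f : Hom L M) : Prop :=
  CatLtOverS.IsStrict (A := L.toCatLtOverS) (B := M.toCatLtOverS) f.toLtHom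

variable {M : LaxOpCat.{u}} {f : Hom L M}

theorem Hom.IsStrict.card_comp (hf : f.IsStrict) : L.card = f.F ⋙ M.card :=
  hf.fst

theorem Hom.IsStrict.app_eq (hf : f.IsStrict) (X : L.C) :
    f.ν.app X = eqToHom (Functor.congr_obj hf.card_comp X) := by
  rw [← eqToHom_app hf.card_comp]
  exact congrArg (NatTrans.app · X) hf.snd

theorem Hom.IsStrict.map_fibObj (hf : f.IsStrict) {X Y : L.C} (g : Y ⟶ X)
    (i : Fin (L.card.obj X).size) :
    f.F.obj (L.fibObj g i) =
      M.fibObj (f.F.map g) ((eqToHom (Functor.congr_obj hf.card_comp X)).toFun i) := by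
  rw [← hf.app_eq]
  exact f.map_fibObj g i

theorem Hom.IsStrict.map_fibMap (hf : f.IsStrict) {X Y Z : L.C} (h : Z ⟶ Y) (g : Y ⟶ X)
    (i : Fin (L.card.obj X).size) :
    HEq (f.F.map (L.fibMap h g i))
      (M.fibMap (f.F.map h) (f.F.map g)
        ((eqToHom (Functor.congr_obj hf.card_comp X)).toFun i)) := by
  rw [← hf.app_eq]
  exact f.map_fibMap h g i

end LaxOpCat

namespace OpCat

variable {O P : OpCat.{u}}

/-- The operadic functor underlying a strict lax-operadic functor between operadic categories. -/
def homOfIsStrict (f : LaxOpCat.Hom O.toLax P.toLax) (hf : f.IsStrict) : Hom O P where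
  F := f.F
  pres := f.pres
  card_comp := hf.card_comp
  map_fibObj := hf.map_fibObj
  map_fibMap := hf.map_fibMap

theorem toLax_homOfIsStrict (f : LaxOpCat.Hom O.toLax P.toLax) (hf : f.IsStrict) :
    (homOfIsStrict f hf).toLax = f :=
  LaxOpCat.Hom.ext' (CatLtOverS.Hom.ext' (congrArg (CatOverS.Hom.mk f.F) hf.snd.symm))

theorem isStrict_toLax (F : Hom O P) : F.toLax.IsStrict :=
  ⟨F.card_comp, rfl⟩

theorem exists_eq_inclusion_map_iff {L M : LaxOpCat.{u}} (hL : L = inclusion.obj O)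
    (hM : M = inclusion.obj P) (f : L ⟶ M) :
    (∃ F : O ⟶ P, f = eqToHom hL ≫ inclusion.map F ≫ eqToHom hM.symm) ↔
      LaxOpCat.Hom.IsStrict f := by
  subst hL hM
  simp only [eqToHom_refl, Category.id_comp, Category.comp_id]
  constructor
  · rintro ⟨F, rfl⟩
    exact isStrict_toLax F
  · intro hf
    exact ⟨homOfIsStrict f hf, (toLax_homOfIsStrict f hf).symm⟩

end OpCat

end Decalage

theorem proposition5 :
    (∀ A : Decalage.modifiedDecalageMonad.{u}.Algebra,
      (∃ O : Decalage.OpCat.{u},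
        Decalage.algebraIso.{u}.hom.toFunctor.obj A = Decalage.OpCat.inclusion.{u}.obj O) ↔
      Decalage.CatLtOverS.IsStrict A.a) ∧
    (∀ (A B : Decalage.modifiedDecalageMonad.{u}.Algebra) (f : A ⟶ B) (O P : Decalage.OpCat.{u})
      (hA : Decalage.algebraIso.{u}.hom.toFunctor.obj A = Decalage.OpCat.inclusion.{u}.obj O)
      (hB : Decalage.algebraIso.{u}.hom.toFunctor.obj B = Decalage.OpCat.inclusion.{u}.obj P),
      (∃ F : O ⟶ P, Decalage.algebraIso.{u}.hom.toFunctor.map f =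
        eqToHom hA ≫ Decalage.OpCat.inclusion.{u}.map F ≫ eqToHom hB.symm) ↔
      Decalage.CatLtOverS.IsStrict f.f) := by
  refine ⟨fun A => ?_, fun A B f O P hA hB => ?_⟩
  · exact Decalage.LaxOpCat.exists_eq_inclusion_obj_iff.trans
      (Decalage.LaxOpCat.hasIdRelabelling_algebraToLax_iff A)
  · exact Decalage.OpCat.exists_eq_inclusion_map_iff hA hB _
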